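/- Consider a cognitive radio network of $M$ secondary users that decide between $H_0$ (no primary user) and $H_1$ (a primary user is present). Under $H_j$ ($j=0,1$) the local measurements $x_1,\dots,x_M$ are independent and identically distributed with an arbitrary law $\nu_j$ on $\mathbb R$ (for instance the chi-squared laws of an energy detector). With thresholds $\eta_0\le\eta_1$, user $i$ forms the local decision $b_i(0)=1$ if $x_i\ge\eta_1$, $b_i(0)=0$ (censoring) if $\eta_0\le x_i<\eta_1$, and $b_i(0)=-1$ if $x_i<\eta_0$; put $\pi_{sj}=\Pr(b_i(0)=s\mid H_j)$ for $s\in\{1,0,-1\}$. At each of the time steps $t=0,\dots,K-1$, with $K\ge1$, each pair of distinct users is linked with probability $p\in(0,1)$, independently over pairs and time steps and independently of the measurements; let $A(t)$ be the (symmetric) adjacency matrix of the links. In the diversity-based binary consensus algorithm each user sends its initial decision at every time step, $b(t)=b(0)$, and finally user $i$ takes the decision $b_i(K)=1$ (that is, $H_1$) if $y_i(K)\ge0$ and $b_i(K)=0$ (that is, $H_0$) otherwise, where $$y(K)=\frac1M\Bigl(b(0)+\frac1{Kp}\sum_{t=0}^{K-1}A(t)\,b(t)\Bigr).$$ Under the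 global-AND rule the probabilities of detection and of false alarm are $$P_d(K)=\Pr(b_i(K)=1\ \forall i\mid H_1),\qquad P_{fa}(K)=\Pr(b_i(K)=1\ \forall i\mid H_0).$$ Let $Q(z)=\frac1{\sqrt{2\pi}}\int_z^\infty e^{-t^2/2}\,dt$, and for $j=0,1$ let $$F_j=\sum_{c=0}^{M}\ \sum_{n=0}^{M-c}\frac{M!}{n!\,c!\,(M-n-c)!}\,\pi_{1j}^{\,n}\,\pi_{0j}^{\,c}\,\pi_{-1j}^{\,M-n-c}\left[1-Q\!\left(\frac{S}{\sqrt{\frac{(1-p)(M-c)}{pK}}}\right)\right]^{c}\left[1-Q\!\left(\frac{S}{\sqrt{\frac{(1-p)(M-1-c)}{pK}}}\right)\right]^{M-c},$$ where $S=2n-(M-c)$ is the sum of the local decisions when $c$ users censor and $n$ users decide $1$ (a quotient with denominator zero, which occurs only for $c\ge M-1$, is read as $0$; a factor with exponent $0$ is $1$). Then, for sufficiently large $M$, $P_d(K)$ is approximated by $F_1$ and $P_{fa}(K)$ by $F_0$, uniformly over sensing laws and thresholds for which the probability of censoring stays away from $1$. Precisely: for all $p\in(0,1)$, $K\ge1$,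 $\delta>0$ and $\varepsilon>0$ there is an $M_0$, depending only on $p,K,\delta,\varepsilon$, such that for all $M\ge M_0$, all probability measures $\nu_0,\nu_1$ on $\mathbb R$ and all $\eta_0\le\eta_1$ with $\pi_{00}\le1-\delta$ and $\pi_{01}\le1-\delta$, $$|P_d(K)-F_1|\le\varepsilon\qquad\text{and}\qquad|P_{fa}(K)-F_0|\le\varepsilon .$$ -/

import Mathlib

open MeasureTheory Matrix
open scoped SimpleGraph Nat

namespace CRN

/-- The two hypotheses on the primary user: `H0` (absent) and `H1` (present). -/
inductive Hypothesis
  | H0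
  | H1

/-! ### Sensing, links and the diversity-based binary consensus algorithm -/

/-- Local decision with censoring, from the measurement `x` and the lower / upper thresholds
`η₀`, `η₁`: the decision `0` means that the user censors its transmission. -/
noncomputable def localDecision (η₀ η₁ x : ℝ) : ℝ :=
  if η₁ ≤ x then 1 else if η₀ ≤ x then 0 else -1

/-- The probability `π_s` that a local decision equals `s ∈ {1, 0, -1}`, when the measurement
has law `ν`. -/
noncomputable def decisionProb (ν : Measure ℝ) (η₀ η₁ s : ℝ) : ℝ :=
  ν.real {x | localDecision η₀ η₁ x = s}

/-- The decision vectors `b(k)` sent at time steps `k = 0, 1, …`: the combining function of the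
diversity-based algorithm is `b(k) = b(k - 1)`. -/
def sentDecisions {M : ℕ} (b₀ : Fin M → ℝ) : ℕ → Fin M → ℝ
  | 0 => b₀
  | k + 1 => sentDecisions b₀ k

/-- The decision threshold `Dec`: `1` stands for deciding `H1`, and `0` for deciding `H0`. -/
noncomputable def dec (x : ℝ) : ℕ := if 0 ≤ x then 1 else 0

open Classical in
/-- The consensus statistic `y(K) = (1 / M) (b(0) + (1 / (K p)) ∑_{t < K} A(t) b(t))`, where `A(t)`
is the adjacency matrix of the graph of the links at time step `t`. -/
noncomputable def consensusStatistic {M K : ℕ} (p : ℝ) (b₀ : Fin M → ℝ)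
    (g : Fin K → SimpleGraph (Fin M)) : Fin M → ℝ :=
  (1 / (M : ℝ)) • (sentDecisions b₀ 0 +
    (1 / ((K : ℝ) * p)) • ∑ t : Fin K, (g t).adjMatrix ℝ *ᵥ sentDecisions b₀ t)

/-- The final decision `b_i(K)` of user `i`. -/
noncomputable def finalDecision {M K : ℕ} (p : ℝ) (b₀ : Fin M → ℝ)
    (g : Fin K → SimpleGraph (Fin M)) (i : Fin M) : ℕ :=
  dec (consensusStatistic p b₀ g i)

/-- The joint law of the `M` measurements and of the link graphs at the `K` time steps. The
measurements are independent with law `ν`; at every time step each pair of distinct users is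
linked with probability `p`, independently of everything else. -/
noncomputable def networkLaw (M K : ℕ) (p : unitInterval) (ν : Measure ℝ) :
    Measure ((Fin M → ℝ) × (Fin K → SimpleGraph (Fin M))) :=
  (Measure.pi fun _ : Fin M => ν).prod (Measure.pi fun _ : Fin K => G(Fin M, p))

/-- The probability that all users finally decide `H1` (the global-AND rule), when the
measurements have law `ν`. -/
noncomputable def globalProb (M K : ℕ) (p : unitInterval) (ν : Measure ℝ) (η₀ η₁ : ℝ) : ℝ :=
  (networkLaw M K p ν).real
    {ω | ∀ i, finalDecision (p : ℝ) (fun j => localDecision η₀ η₁ (ω.1 j)) ω.2 i = 1}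

/-- Global probability of detection `P_d(K)`; `ν h` is the law of a measurement under `h`. -/
noncomputable def detectionProb (M K : ℕ) (p : unitInterval) (ν : Hypothesis → Measure ℝ)
    (η₀ η₁ : ℝ) : ℝ :=
  globalProb M K p (ν Hypothesis.H1) η₀ η₁

/-- Global probability of false alarm `P_fa(K)`; `ν h` is the law of a measurement under `h`. -/
noncomputable def falseAlarmProb (M K : ℕ) (p : unitInterval) (ν : Hypothesis → Measure ℝ)
    (η₀ η₁ : ℝ) : ℝ :=
  globalProb M K p (ν Hypothesis.H0) η₀ η₁

/-! ### The Gaussian approximation -/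

/-- The Gaussian tail function `Q`. -/
noncomputable def gaussQ (z : ℝ) : ℝ :=
  1 / √(2 * Real.pi) * ∫ t in Set.Ioi z, Real.exp (-t ^ 2 / 2)

/-- The approximating sum over the number `c` of censoring users and the number `n` of users with
local decision `1`; the sum of the local decisions is then `2 n - (M - c)`. The arguments are the
probabilities `q₁`, `q₀`, `q₂` of the local decisions `1`, `0`, `-1`. Denominators vanish only in
terms with `c ≥ M - 1`, where a quotient with denominator `0` is read as `0`. -/
noncomputable def approxSum (M K : ℕ) (p q₁ q₀ q₂ : ℝ) : ℝ :=
  ∑ c ∈ Finset.range (M + 1), ∑ n ∈ Finset.range (M - c + 1),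
    ((M ! : ℝ) / ((n ! : ℝ) * (c ! : ℝ) * ((M - n - c)! : ℝ))) *
      (q₁ ^ n * q₀ ^ c * q₂ ^ (M - n - c)) *
      (1 - gaussQ ((2 * (n : ℝ) - ((M : ℝ) - c)) /
        √((1 - p) * ((M : ℝ) - c) / (p * K)))) ^ c *
      (1 - gaussQ ((2 * (n : ℝ) - ((M : ℝ) - c)) /
        √((1 - p) * ((M : ℝ) - 1 - c) / (p * K)))) ^ (M - c)

end CRN

/-! Fix the local decisions, with N active users and sum S. User i decides `H1` exactly when its
link noise is at most K p S, and this noise is a signed sum of about K N independent centered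
Bernoulli variables, of standard deviation about σ = √(p(1-p)KN). With L = √(2 log M), the largest
of the M noises is about σ L, just as for M independent Gaussians. Hence the true conditional
probability and the product of Gaussian factors have the same sharp threshold in S, at the scale
`statScale` = σ/(Kp): both are near 1 when S exceeds it by w and near 0 when S falls short by w
(`eventually_one_sub_le_passProb`, `eventually_passProb_le`, `eventually_one_sub_le_gaussFactor`,
`eventually_gaussFactor_le`).

It remains to see that S rarely lies within w of the threshold. Given the number of censoring users,
the number of decisions 1 is binomial, with point probabilities at most 2/√N in the relevant range
whatever its parameter; the window has width of order w√N, so its probability is of order w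
(`exists_window_exceptional_le`). Censoring bounded away from 1 keeps N of order M. No estimate
depends on the sensing law, which gives uniformity.

Above the threshold a union bound with Chernoff's inequality is enough. Below it there are two
difficulties. The noises of i and j share the link ij, so they are dependent: only about M/L⁴ users
are kept, their noises due to the remaining users are independent, and the links among the kept
users contribute little (`passProb_le`). Also, a lower tail bound is needed at l standard deviations
with l growing like √(log M), beyond the central limit theorem: the mass function of a signed
Bernoulli sum is log-concave, and exponential tilting together with log-concavity bounds it below
pointwise just beyond l (`StrongLogConcave.tail_lower`). -/

/-! ### Log-concave sequences and lower bounds on tails -/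

/-- Strong log-concavity of a sequence indexed by the integers; it excludes internal zeros. -/
def StrongLogConcave (a : ℤ → ℝ) : Prop :=
  ∀ i j, i ≤ j → a (i - 1) * a (j + 1) ≤ a i * a j

namespace StrongLogConcave

variable {a : ℤ → ℝ}

lemma spread (ha : StrongLogConcave a) (k : ℕ) {i j : ℤ} (hij : i ≤ j) :
    a (i - k) * a (j + k) ≤ a i * a j := by
  induction k with
  | zero => simp
  | succ k ih =>
    refine le_trans ?_ ih
    have h := ha (i - k) (j + k) (by omega)
    have e1 : i - ((k + 1 : ℕ) : ℤ) = i - k - 1 := by push_cast; ring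
    have e2 : j + ((k + 1 : ℕ) : ℤ) = j + k + 1 := by push_cast; ring
    rwa [e1, e2]

/-- The index pairs on the two sides have the same sum, so exponential tilting multiplies both sides
by the same factor. -/
lemma mul_geometric (ha : StrongLogConcave a) {r : ℝ} (hr : 0 < r) {C : ℝ} :
    StrongLogConcave fun n => C * r ^ n * a n := by
  intro i j hij
  have h := ha i j hij
  have e : r ^ (i - 1) * r ^ (j + 1) = r ^ i * r ^ j := by
    rw [← zpow_add₀ hr.ne', ← zpow_add₀ hr.ne']; congr 1; ring
  calc C * r ^ (i - 1) * a (i - 1) * (C * r ^ (j + 1) * a (j + 1))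
      = C ^ 2 * (r ^ (i - 1) * r ^ (j + 1)) * (a (i - 1) * a (j + 1)) := by ring
    _ ≤ C ^ 2 * (r ^ i * r ^ j) * (a i * a j) := by
        rw [e]; exact mul_le_mul_of_nonneg_left h (by positivity)
    _ = _ := by ring

/-- A log-concave sequence is at least `c` between two places where it is at least `c`. -/
lemma le_of_mem_Icc (ha : StrongLogConcave a) (h0 : ∀ n, 0 ≤ a n) {c : ℝ} (hc : 0 < c)
    {m n k : ℤ} (hm : c ≤ a m) (hn : c ≤ a n) (hmk : m ≤ k) (hkn : k ≤ n) : c ≤ a k := by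
  -- There are no internal zeros: l is paired with its mirror image m + n - l, and the pair is
  -- spread outward to (m, n).
  have hpos : ∀ l, m ≤ l → l ≤ n → 0 < a l := by
    intro l hml hln
    have key : a m * a n ≤ a l * a (m + n - l) := by
      rcases le_total l (m + n - l) with h | h
      · have := ha.spread (l - m).toNat h
        have e : ((l - m).toNat : ℤ) = l - m := by omega
        rw [e] at this
        convert this using 2 <;> congr 1 <;> ring
      · have := ha.spread (n - l).toNat h
        have e : ((n - l).toNat : ℤ) = n - l := by omega
        rw [e, mul_comm (a (m + n - l))] at this
        convert this using 2 <;> congr 1 <;> ring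
    refine lt_of_le_of_ne (h0 l) fun h => ?_
    rw [← h, zero_mul] at key
    have : 0 < a m * a n := mul_pos (hc.trans_le hm) (hc.trans_le hn)
    linarith
  by_contra! hk
  -- The lexicographic order selects the leftmost minimizer, so that the left neighbour is strictly
  -- larger; with a positive minimum this contradicts log-concavity at l.
  obtain ⟨l, hl, hmin⟩ := Finset.exists_min_image (Finset.Icc m n) (fun l => toLex (a l, l))
    ⟨k, Finset.mem_Icc.2 ⟨hmk, hkn⟩⟩
  rw [Finset.mem_Icc] at hl
  have hmin' : ∀ i, m ≤ i → i ≤ n → a l < a i ∨ a l = a i ∧ l ≤ i := fun i h1 h2 => by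
    simpa [Prod.Lex.toLex_le_toLex] using hmin i (Finset.mem_Icc.2 ⟨h1, h2⟩)
  have hlc : a l < c := by
    rcases hmin' k hmk hkn with h | h
    · linarith
    · linarith [h.1]
  have h1 : m < l := lt_of_le_of_ne hl.1 fun h => by rw [← h] at hlc; linarith
  have h2 : l < n := lt_of_le_of_ne hl.2 fun h => by rw [h] at hlc; linarith
  have h3 : a l < a (l - 1) := by
    rcases hmin' (l - 1) (by omega) (by omega) with h | h
    · exact h
    · omega
  have h4 : a l ≤ a (l + 1) := by
    rcases hmin' (l + 1) (by omega) (by omega) with h | h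
    · exact h.le
    · exact h.1.le
  have h5 := ha l l le_rfl
  have h6 := hpos l hl.1 hl.2
  nlinarith

/-- Adding an independent variable with values `0` and `1` preserves log-concavity. -/
lemma convolve_right (ha : StrongLogConcave a) {p q : ℝ} (hp : 0 ≤ p) (hq : 0 ≤ q) :
    StrongLogConcave fun n => q * a n + p * a (n - 1) := by
  intro i j hij
  have h1 := ha i j hij
  have h2 := ha (i - 1) (j - 1) (by omega)
  -- This is what remains of the mixed terms once a (i - 1) * a j cancels. For i < j it takes two
  -- inward steps; for i = j the second step is an equality.
  have h3 : a (i - 1 - 1) * a (j + 1) ≤ a i * a (j - 1) := by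
    rcases eq_or_lt_of_le hij with rfl | h
    · have := ha (i - 1) i (by omega)
      linarith [mul_comm (a i) (a (i - 1))]
    · have e1 := ha (i - 1) j (by omega)
      have e2 := ha i (j - 1) (by omega)
      rw [sub_add_cancel] at e2
      linarith
  rw [sub_add_cancel] at h2
  simp only [add_sub_cancel_right]
  have t1 := mul_le_mul_of_nonneg_left h1 (mul_nonneg hq hq)
  have t2 := mul_le_mul_of_nonneg_left h2 (mul_nonneg hp hp)
  have t3 := mul_le_mul_of_nonneg_left h3 (mul_nonneg hp hq)
  nlinarith

lemma reflect (ha : StrongLogConcave a) : StrongLogConcave fun n => a (-n) := by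
  intro i j hij
  have := ha (-j) (-i) (by omega)
  have e1 : -(i - 1) = -i + 1 := by ring
  have e2 : -(j + 1) = -j - 1 := by ring
  simp only [e1, e2]
  linarith [mul_comm (a (-j - 1)) (a (-i + 1)), mul_comm (a (-j)) (a (-i))]

/-- Adding an independent variable with values `0` and `-1` preserves log-concavity. -/
lemma convolve_left (ha : StrongLogConcave a) {p q : ℝ} (hp : 0 ≤ p) (hq : 0 ≤ q) :
    StrongLogConcave fun n => q * a n + p * a (n + 1) := by
  have h := (ha.reflect.convolve_right hp hq).reflect
  convert h using 4 with n <;> congr 1 <;> ring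

end StrongLogConcave

/-! ### Tilting and tails of log-concave sequences -/

/-- Exponential tilting by `u`, with Chernoff bounds on both sides, locates a point at distance at
most `2` from `u` that carries its share of the tilted mass. -/
lemma exists_tilted_mass {a : ℤ → ℝ} (h0 : ∀ n, 0 ≤ a n) (T : Finset ℤ) {m σ : ℝ} (hσ : 1 ≤ σ)
    {u : ℝ}
    (hu : 9 / 10 * Real.exp (u ^ 2 / 2) ≤ ∑ n ∈ T, a n * Real.exp (u * ((n - m) / σ)))
    (hr : ∑ n ∈ T, a n * Real.exp ((u + 2) * ((n - m) / σ)) ≤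
      10 / 9 * Real.exp ((u + 2) ^ 2 / 2))
    (hl : ∑ n ∈ T, a n * Real.exp ((u - 2) * ((n - m) / σ)) ≤
      10 / 9 * Real.exp ((u - 2) ^ 2 / 2)) :
    ∃ n : ℤ, |(n - m) / σ - u| ≤ 2 ∧
      Real.exp (u ^ 2 / 2) / (10 * σ) ≤ a n * Real.exp (u * ((n - m) / σ)) := by
  have hσ0 : 0 < σ := by linarith
  set E := Real.exp (u ^ 2 / 2) with hE
  have hE0 : 0 < E := Real.exp_pos _
  set W := T.filter fun n : ℤ => |(n - m) / σ - u| ≤ 2 with hW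
  -- Off the window, tilting by 2 more to the appropriate side only increases the term. Summed, each
  -- side contributes at most (10/9) e⁻² E, which leaves more than E/2 of the tilted mass in the
  -- window.
  have hpt : ∀ n ∈ T, a n * Real.exp (u * ((n - m) / σ)) ≤
      (if |(n - m) / σ - u| ≤ 2 then a n * Real.exp (u * ((n - m) / σ)) else 0) +
      (Real.exp (-2 * u - 4) * (a n * Real.exp ((u + 2) * ((n - m) / σ))) +
        Real.exp (2 * u - 4) * (a n * Real.exp ((u - 2) * ((n - m) / σ)))) := by
    intro n _
    set x := ((n : ℝ) - m) / σ
    have ha := h0 n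
    have e1 : Real.exp (-2 * u - 4) * (a n * Real.exp ((u + 2) * x)) =
        a n * Real.exp (u * x + 2 * (x - u - 2)) := by
      rw [mul_left_comm, ← Real.exp_add]; ring_nf
    have e2 : Real.exp (2 * u - 4) * (a n * Real.exp ((u - 2) * x)) =
        a n * Real.exp (u * x + 2 * (u - x - 2)) := by
      rw [mul_left_comm, ← Real.exp_add]; ring_nf
    have p1 : 0 ≤ a n * Real.exp (u * x + 2 * (x - u - 2)) := by positivity
    have p2 : 0 ≤ a n * Real.exp (u * x + 2 * (u - x - 2)) := by positivity
    rw [e1, e2]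
    split_ifs with h
    · linarith
    · rw [abs_le, not_and_or] at h
      rcases h with h | h
      · have : a n * Real.exp (u * x) ≤ a n * Real.exp (u * x + 2 * (u - x - 2)) :=
          mul_le_mul_of_nonneg_left (Real.exp_le_exp.2 (by linarith)) ha
        linarith
      · have : a n * Real.exp (u * x) ≤ a n * Real.exp (u * x + 2 * (x - u - 2)) :=
          mul_le_mul_of_nonneg_left (Real.exp_le_exp.2 (by linarith)) ha
        linarith
  have hsum := hu.trans (Finset.sum_le_sum hpt)
  rw [Finset.sum_add_distrib, Finset.sum_add_distrib, ← Finset.mul_sum, ← Finset.mul_sum,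
    ← Finset.sum_filter] at hsum
  have b1 : Real.exp (-2 * u - 4) * ∑ n ∈ T, a n * Real.exp ((u + 2) * ((n - m) / σ)) ≤
      10 / 9 * Real.exp (-2) * E := by
    calc _ ≤ Real.exp (-2 * u - 4) * (10 / 9 * Real.exp ((u + 2) ^ 2 / 2)) :=
          mul_le_mul_of_nonneg_left hr (Real.exp_pos _).le
      _ = 10 / 9 * (Real.exp (-2 * u - 4) * Real.exp ((u + 2) ^ 2 / 2)) := by ring
      _ = 10 / 9 * (Real.exp (-2) * E) := by
          rw [hE, ← Real.exp_add, ← Real.exp_add]; ring_nf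
      _ = _ := by ring
  have b2 : Real.exp (2 * u - 4) * ∑ n ∈ T, a n * Real.exp ((u - 2) * ((n - m) / σ)) ≤
      10 / 9 * Real.exp (-2) * E := by
    calc _ ≤ Real.exp (2 * u - 4) * (10 / 9 * Real.exp ((u - 2) ^ 2 / 2)) :=
          mul_le_mul_of_nonneg_left hl (Real.exp_pos _).le
      _ = 10 / 9 * (Real.exp (2 * u - 4) * Real.exp ((u - 2) ^ 2 / 2)) := by ring
      _ = 10 / 9 * (Real.exp (-2) * E) := by
          rw [hE, ← Real.exp_add, ← Real.exp_add]; ring_nf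
      _ = _ := by ring
  have hexp : Real.exp (-2) ≤ 7 / 50 := by
    have h1 : Real.exp (-2) = (Real.exp (-1)) ^ 2 := by rw [← Real.exp_nat_mul]; norm_num
    have h2 := Real.exp_neg_one_lt_d9
    rw [h1]
    nlinarith [Real.exp_pos (-1)]
  have hW2 : E / 2 < ∑ n ∈ W, a n * Real.exp (u * ((n - m) / σ)) := by
    have : Real.exp (-2) * E ≤ 7 / 50 * E := mul_le_mul_of_nonneg_right hexp hE0.le
    linarith
  -- The window has length 4σ and σ ≥ 1, so it contains at most 4σ + 1 ≤ 5σ integers; one of them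
  -- carries at least E/(10σ).
  have hcard : (W.card : ℝ) ≤ 5 * σ := by
    have hsub : W ⊆ Finset.Icc ⌈m + σ * (u - 2)⌉ ⌊m + σ * (u + 2)⌋ := by
      intro n hn
      have h := (Finset.mem_filter.1 hn).2
      rw [abs_le] at h
      have e : ((n : ℝ) - m) / σ * σ = n - m := div_mul_cancel₀ _ hσ0.ne'
      rw [Finset.mem_Icc, Int.ceil_le, Int.le_floor]
      constructor <;> nlinarith [h.1, h.2]
    have h1 : (W.card : ℝ) ≤ ((⌊m + σ * (u + 2)⌋ + 1 - ⌈m + σ * (u - 2)⌉).toNat : ℝ) := by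
      have := Finset.card_le_card hsub
      rw [Int.card_Icc] at this
      exact_mod_cast this
    have h2 := Int.floor_le (m + σ * (u + 2))
    have h3 := Int.le_ceil (m + σ * (u - 2))
    rcases le_total 0 (⌊m + σ * (u + 2)⌋ + 1 - ⌈m + σ * (u - 2)⌉) with h | h
    · have h4 : ((⌊m + σ * (u + 2)⌋ + 1 - ⌈m + σ * (u - 2)⌉).toNat : ℝ) =
          (⌊m + σ * (u + 2)⌋ : ℝ) + 1 - ⌈m + σ * (u - 2)⌉ := by
        have := congrArg (Int.cast (R := ℝ)) (Int.toNat_of_nonneg h)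
        push_cast at this
        exact this
      linarith
    · rw [Int.toNat_of_nonpos h] at h1
      simp only [CharP.cast_eq_zero] at h1
      linarith
  by_contra! hno
  have : ∑ n ∈ W, a n * Real.exp (u * ((n - m) / σ)) ≤ W.card • (E / (10 * σ)) :=
    Finset.sum_le_card_nsmul _ _ _ fun n hn => (hno n (Finset.mem_filter.1 hn).2).le
  rw [nsmul_eq_mul] at this
  have h3 : (W.card : ℝ) * (E / (10 * σ)) ≤ 5 * σ * (E / (10 * σ)) :=
    mul_le_mul_of_nonneg_right hcard (by positivity)
  have h4 : 5 * σ * (E / (10 * σ)) = E / 2 := by field_simp; norm_num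
  linarith

/-- Lower bound on the Gaussian scale for the tail of a log-concave sequence whose exponential
moments are close to those of the Gaussian. -/
lemma StrongLogConcave.tail_lower {a : ℤ → ℝ} (ha : StrongLogConcave a) (h0 : ∀ n, 0 ≤ a n)
    (T : Finset ℤ) (hT : ∀ n ∉ T, a n = 0) {m σ l : ℝ} (hl : 1 ≤ l) (hσ : 2 * l ≤ σ)
    (hlow : ∀ u, |u| ≤ l + 10 →
      9 / 10 * Real.exp (u ^ 2 / 2) ≤ ∑ n ∈ T, a n * Real.exp (u * ((n - m) / σ)))
    (hup : ∀ u, |u| ≤ l + 10 →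
      ∑ n ∈ T, a n * Real.exp (u * ((n - m) / σ)) ≤ 10 / 9 * Real.exp (u ^ 2 / 2)) :
    Real.exp (-12) / (20 * l) * Real.exp (-l ^ 2 / 2) ≤
      ∑ n ∈ T.filter fun n : ℤ => l < (n - m) / σ, a n := by
  have hσ1 : 1 ≤ σ := by linarith
  have hσ0 : 0 < σ := by linarith
  have hl0 : 0 < l := by linarith
  set x : ℤ → ℝ := fun n => (n - m) / σ with hx
  have hxle : ∀ i j, x i ≤ x j → i ≤ j := fun i j hij => by
    simp only [hx] at hij
    rw [div_le_div_iff_of_pos_right hσ0] at hij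
    have : (i : ℝ) ≤ j := by linarith
    exact_mod_cast this
  have habs : ∀ t, |t| ≤ 9 → |l + t| ≤ l + 10 := fun t ht => by
    rw [abs_le] at ht ⊢; constructor <;> linarith [ht.1, ht.2]
  -- The tilts l - 2 and l + 3 put the two points in [l - 4, l] and [l + 1, l + 5], on either side
  -- of the interval (l, l + 1].
  obtain ⟨n₁, h11, h12⟩ := exists_tilted_mass h0 T hσ1 (u := l + -2) (hlow _ (habs _ (by norm_num)))
    (by rw [add_assoc]; exact hup _ (habs _ (by norm_num)))
    (by rw [add_sub_assoc]; exact hup _ (habs _ (by norm_num)))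
  obtain ⟨n₂, h21, h22⟩ := exists_tilted_mass h0 T hσ1 (u := l + 3) (hlow _ (habs _ (by norm_num)))
    (by rw [add_assoc]; exact hup _ (habs _ (by norm_num)))
    (by rw [add_sub_assoc]; exact hup _ (habs _ (by norm_num)))
  rw [abs_le] at h11 h21
  set b : ℤ → ℝ := fun n => a n * Real.exp (l * x n) with hb
  have hbLC : StrongLogConcave b := by
    have := ha.mul_geometric (r := Real.exp (l / σ)) (Real.exp_pos _)
      (C := Real.exp (-(l * m / σ)))
    convert this using 2 with n
    simp only [hb, hx]
    rw [← Real.rpow_intCast, ← Real.exp_mul, ← Real.exp_add, mul_comm]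
    congr 2; field_simp; ring
  have hb0 : ∀ n, 0 ≤ b n := fun n => mul_nonneg (h0 n) (Real.exp_pos _).le
  -- Passing to the common tilt l costs at most 6 in the exponent at n₁ and 10.5 at n₂; 11 covers
  -- both.
  set c := Real.exp (l ^ 2 / 2 - 11) / (10 * σ) with hc
  have hc0 : 0 < c := by positivity
  have hb1 : c ≤ b n₁ := by
    have h := mul_le_mul_of_nonneg_right h12 (Real.exp_pos (2 * x n₁)).le
    have e : a n₁ * Real.exp ((l + -2) * ((n₁ - m) / σ)) * Real.exp (2 * x n₁) = b n₁ := by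
      simp only [hb, hx]; rw [mul_assoc, ← Real.exp_add]; congr 2; ring
    rw [e, div_mul_eq_mul_div, ← Real.exp_add] at h
    refine le_trans ?_ h
    rw [hc]
    gcongr
    change l ^ 2 / 2 - 11 ≤ (l + -2) ^ 2 / 2 + 2 * ((n₁ - m) / σ)
    nlinarith [h11.1]
  have hb2 : c ≤ b n₂ := by
    have h := mul_le_mul_of_nonneg_right h22 (Real.exp_pos (-3 * x n₂)).le
    have e : a n₂ * Real.exp ((l + 3) * ((n₂ - m) / σ)) * Real.exp (-3 * x n₂) = b n₂ := by
      simp only [hb, hx]; rw [mul_assoc, ← Real.exp_add]; congr 2; ring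
    rw [e, div_mul_eq_mul_div, ← Real.exp_add] at h
    refine le_trans ?_ h
    rw [hc]
    gcongr
    change l ^ 2 / 2 - 11 ≤ (l + 3) ^ 2 / 2 + -3 * ((n₂ - m) / σ)
    nlinarith [h21.2]
  have hbetween : ∀ n, l < x n → x n ≤ l + 1 → c ≤ b n := fun n h1 h2 =>
    hbLC.le_of_mem_Icc hb0 hc0 hb1 hb2
      (hxle _ _ (by simp only [hx] at h1 ⊢; linarith [h11.2]))
      (hxle _ _ (by simp only [hx] at h2 ⊢; linarith [h21.1]))
  have hinv : 1 / l ≤ 1 := by rw [div_le_one hl0]; exact hl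
  -- Over a normalized length 1/l, undoing the tilt costs only one extra factor e⁻¹, hence the
  -- constant e⁻¹². Since σ ≥ 2l, there are still at least σ/(2l) integers.
  set J := Finset.Ioc ⌊m + σ * l⌋ ⌊m + σ * (l + 1 / l)⌋ with hJ
  have hJx : ∀ n ∈ J, l < x n ∧ x n ≤ l + 1 / l := fun n hn => by
    rw [hJ, Finset.mem_Ioc, Int.floor_lt, Int.le_floor] at hn
    simp only [hx]
    rw [lt_div_iff₀ hσ0, div_le_iff₀ hσ0]
    constructor <;> linarith [hn.1, hn.2]
  have haJ : ∀ n ∈ J, Real.exp (-12) * Real.exp (-l ^ 2 / 2) / (10 * σ) ≤ a n := fun n hn => by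
    obtain ⟨h1, h2⟩ := hJx n hn
    have h := mul_le_mul_of_nonneg_right (hbetween n h1 (by linarith)) (Real.exp_pos (-l * x n)).le
    have e : b n * Real.exp (-l * x n) = a n := by
      simp only [hb]; rw [mul_assoc, ← Real.exp_add]; ring_nf; simp
    rw [e, hc, div_mul_eq_mul_div, ← Real.exp_add] at h
    refine le_trans ?_ h
    rw [← Real.exp_add]
    refine div_le_div_of_nonneg_right (Real.exp_le_exp.2 ?_) (by positivity)
    have : l * x n ≤ l * (l + 1 / l) := mul_le_mul_of_nonneg_left h2 hl0.le
    have e2 : l * (l + 1 / l) = l ^ 2 + 1 := by field_simp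
    linarith
  have hcard : σ / (2 * l) ≤ (J.card : ℝ) := by
    have h1 := Int.floor_le (m + σ * l)
    have h2 := Int.lt_floor_add_one (m + σ * (l + 1 / l))
    rw [hJ, Int.card_Ioc]
    have h3 : ((⌊m + σ * (l + 1 / l)⌋ - ⌊m + σ * l⌋ : ℤ) : ℝ) ≤
        ((⌊m + σ * (l + 1 / l)⌋ - ⌊m + σ * l⌋).toNat : ℝ) := by
      exact_mod_cast Int.self_le_toNat _
    push_cast at h3
    have h4 : σ * (l + 1 / l) = σ * l + 2 * (σ / (2 * l)) := by field_simp
    have h5 : 1 ≤ σ / (2 * l) := by rw [le_div_iff₀ (by positivity)]; linarith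
    linarith
  have hpos : 0 < Real.exp (-12) * Real.exp (-l ^ 2 / 2) / (10 * σ) := by positivity
  calc Real.exp (-12) / (20 * l) * Real.exp (-l ^ 2 / 2)
      = σ / (2 * l) * (Real.exp (-12) * Real.exp (-l ^ 2 / 2) / (10 * σ)) := by field_simp; norm_num
    _ ≤ J.card * (Real.exp (-12) * Real.exp (-l ^ 2 / 2) / (10 * σ)) :=
        mul_le_mul_of_nonneg_right hcard hpos.le
    _ = J.card • (Real.exp (-12) * Real.exp (-l ^ 2 / 2) / (10 * σ)) := by rw [nsmul_eq_mul]
    _ ≤ ∑ n ∈ J, a n := Finset.card_nsmul_le_sum _ _ _ haJ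
    _ ≤ ∑ n ∈ T.filter fun n : ℤ => l < (n - m) / σ, a n := by
        refine Finset.sum_le_sum_of_subset_of_nonneg (fun n hn => ?_) fun n _ _ => h0 n
        rw [Finset.mem_filter]
        refine ⟨?_, (hJx n hn).1⟩
        by_contra hnT
        have := haJ n hn
        rw [hT n hnT] at this
        linarith

/-! ### Sums of signed independent Bernoulli variables -/

/-- The family `ξ` is independent with values `0` and `1`, and takes the value `1` with
probability `p` on the index set `s`. -/
structure BernoulliFamily {Ω ι : Type*} [MeasurableSpace Ω] (μ : Measure Ω) (ξ : ι → Ω → ℤ)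
    (s : Finset ι) (p : ℝ) : Prop where
  measurable : ∀ k, Measurable (ξ k)
  indep : ProbabilityTheory.iIndepFun ξ μ
  zero_or_one : ∀ k ω, ξ k ω = 0 ∨ ξ k ω = 1
  prob : ∀ k ∈ s, μ.real {ω | ξ k ω = 1} = p

namespace BernoulliFamily

variable {Ω ι : Type*} [MeasurableSpace Ω] {μ : Measure Ω} {ξ : ι → Ω → ℤ} {s : Finset ι} {p : ℝ}

lemma mono (h : BernoulliFamily μ ξ s p) {t : Finset ι} (hts : t ⊆ s) : BernoulliFamily μ ξ t p :=
  ⟨h.measurable, h.indep, h.zero_or_one, fun k hk => h.prob k (hts hk)⟩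

lemma prob_zero [IsProbabilityMeasure μ] (h : BernoulliFamily μ ξ s p) {k : ι} (hk : k ∈ s) :
    μ.real {ω | ξ k ω = 0} = 1 - p := by
  have e : {ω | ξ k ω = 0} = {ω | ξ k ω = 1}ᶜ := by
    ext ω
    rcases h.zero_or_one k ω with h | h <;> simp [h]
  have hm : MeasurableSet {ω | ξ k ω = 1} := h.measurable k (measurableSet_singleton 1)
  rw [e, probReal_compl_eq_one_sub hm, h.prob k hk]

lemma measurable_signed_sum (h : BernoulliFamily μ ξ s p) (ε : ι → ℤ) (t : Finset ι) :
    Measurable fun ω => ∑ k ∈ t, ε k * ξ k ω :=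
  Finset.measurable_sum _ fun k _ => (h.measurable k).const_mul _

/-- The probability mass function of a signed sum of independent variables, one term at a time. -/
lemma pmf_insert [IsProbabilityMeasure μ] [DecidableEq ι] {k : ι}
    (hk : k ∉ s) (h : BernoulliFamily μ ξ (insert k s) p) (ε : ι → ℤ) (n : ℤ) :
    μ.real {ω | ∑ i ∈ insert k s, ε i * ξ i ω = n} =
      (1 - p) * μ.real {ω | ∑ i ∈ s, ε i * ξ i ω = n} +
        p * μ.real {ω | ∑ i ∈ s, ε i * ξ i ω = n - ε k} := by
  have hind : ProbabilityTheory.IndepFun (fun ω => ∑ i ∈ s, ε i * ξ i ω) (ξ k) μ := by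
    have h1 := (h.indep.indepFun_finset s {k} (by simpa using hk) h.measurable)
    have hf : Measurable fun x : s → ℤ => ∑ i : s, ε i * x i := by fun_prop
    have hg : Measurable fun x : ({k} : Finset ι) → ℤ => x ⟨k, by simp⟩ := by fun_prop
    convert h1.comp hf hg using 1
    · ext ω
      exact (Finset.sum_coe_sort s fun i => ε i * ξ i ω).symm
    · rfl
  have hkk : k ∈ insert k s := Finset.mem_insert_self _ _
  have key : ∀ m l : ℤ, μ.real ({ω | ∑ i ∈ s, ε i * ξ i ω = m} ∩ {ω | ξ k ω = l}) =
      μ.real {ω | ∑ i ∈ s, ε i * ξ i ω = m} * μ.real {ω | ξ k ω = l} := fun m l => by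
    have := hind.measure_inter_preimage_eq_mul {m} {l} (measurableSet_singleton _)
      (measurableSet_singleton _)
    simp only [measureReal_def, ← ENNReal.toReal_mul]
    exact congrArg ENNReal.toReal this
  have hset : {ω | ∑ i ∈ insert k s, ε i * ξ i ω = n} =
      ({ω | ∑ i ∈ s, ε i * ξ i ω = n} ∩ {ω | ξ k ω = 0}) ∪
        ({ω | ∑ i ∈ s, ε i * ξ i ω = n - ε k} ∩ {ω | ξ k ω = 1}) := by
    ext ω
    simp only [Finset.sum_insert hk, Set.mem_ofPred_eq, Set.mem_union, Set.mem_inter_iff]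
    rcases h.zero_or_one k ω with h | h <;> simp [h]
    omega
  have hdisj : Disjoint ({ω | ∑ i ∈ s, ε i * ξ i ω = n} ∩ {ω | ξ k ω = 0})
      ({ω | ∑ i ∈ s, ε i * ξ i ω = n - ε k} ∩ {ω | ξ k ω = 1}) := by
    rw [Set.disjoint_left]
    rintro ω ⟨_, h1⟩ ⟨_, h2⟩
    simp only [Set.mem_ofPred_eq] at h1 h2
    omega
  have hm : MeasurableSet ({ω | ∑ i ∈ s, ε i * ξ i ω = n - ε k} ∩ {ω | ξ k ω = 1}) :=
    (h.measurable_signed_sum ε s (measurableSet_singleton _)).inter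
      (h.measurable k (measurableSet_singleton _))
  rw [hset, measureReal_union hdisj hm, key, key, h.prob_zero hkk, h.prob k hkk]
  ring

/-- Start from the point mass at 0; each further term is a convolution with a Bernoulli law on {0,
1} or {0, -1} according to its sign. -/
lemma strongLogConcave_pmf [IsProbabilityMeasure μ] (h : BernoulliFamily μ ξ s p) (hp0 : 0 ≤ p)
    (hp1 : p ≤ 1) (ε : ι → ℤ) (hε : ∀ k, ε k = 1 ∨ ε k = -1) :
    StrongLogConcave fun n => μ.real {ω | ∑ i ∈ s, ε i * ξ i ω = n} := by
  classical
  induction s using Finset.induction_on with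
  | empty =>
    intro i j hij
    simp only [Finset.sum_empty]
    by_cases hi : 0 = i - 1
    · have : ¬ (0 = j + 1) := by omega
      simp only [this]
      simp only [Set.ofPred_false, measureReal_empty, mul_zero]
      positivity
    · simp only [hi]
      simp only [Set.ofPred_false, measureReal_empty, zero_mul]
      positivity
  | insert k s hk ih =>
    have h' := ih (h.mono (Finset.subset_insert _ _))
    have e := fun n => pmf_insert hk h ε n
    simp only [e]
    rcases hε k with h1 | h1
    · simp only [h1]
      exact h'.convolve_right hp0 (by linarith)
    · simp only [h1, sub_neg_eq_add]
      exact h'.convolve_left hp0 (by linarith)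

/-! ### Exponential moments of centered signed sums -/

/-- The centered signed sum. -/
def centeredSum (ξ : ι → Ω → ℤ) (p : ℝ) (ε : ι → ℤ) (s : Finset ι) (ω : Ω) : ℝ :=
  ∑ k ∈ s, (ε k : ℝ) * ((ξ k ω : ℝ) - p)

/-- The moment generating function of a centered Bernoulli variable. -/
noncomputable def centeredMGF (p θ : ℝ) : ℝ :=
  p * Real.exp (θ * (1 - p)) + (1 - p) * Real.exp (θ * (0 - p))

lemma integral_comp_of_mem_finset [IsProbabilityMeasure μ] {Z : Ω → ℤ} (hZ : Measurable Z)
    (T : Finset ℤ) (hT : ∀ ω, Z ω ∈ T) (f : ℤ → ℝ) :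
    ∫ ω, f (Z ω) ∂μ = ∑ n ∈ T, μ.real {ω | Z ω = n} * f n := by
  have e : ∀ ω, f (Z ω) = ∑ n ∈ T, ({ω | Z ω = n}.indicator (fun _ => f n) ω) := fun ω => by
    rw [Finset.sum_eq_single (Z ω)]
    · simp
    · intro b _ hb
      simp [hb.symm]
    · exact fun h => absurd (hT ω) h
  have hm : ∀ n, MeasurableSet {ω | Z ω = n} := fun n => hZ (measurableSet_singleton n)
  simp_rw [e]
  rw [integral_finsetSum _ fun n _ => (integrable_const _).indicator (hm n)]
  refine Finset.sum_congr rfl fun n _ => ?_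
  rw [integral_indicator_const _ (hm n), smul_eq_mul]

lemma measurable_centeredSum (h : BernoulliFamily μ ξ s p) (ε : ι → ℤ) (t : Finset ι) :
    Measurable (centeredSum ξ p ε t) := by
  unfold centeredSum
  refine Finset.measurable_sum _ fun k _ => ((Measurable.sub_const ?_ _).const_mul _)
  exact (measurable_from_top (f := fun n : ℤ => (n : ℝ))).comp (h.measurable k)

lemma mgf_centeredSum [IsProbabilityMeasure μ] (h : BernoulliFamily μ ξ s p) (ε : ι → ℤ) (θ : ℝ) :
    ∫ ω, Real.exp (θ * centeredSum ξ p ε s ω) ∂μ = ∏ k ∈ s, centeredMGF p (ε k * θ) := by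
  have hcast : Measurable (fun n : ℤ => (n : ℝ)) := measurable_from_top
  have hm : ∀ k, Measurable fun ω => (ε k : ℝ) * ((ξ k ω : ℝ) - p) := fun k =>
    ((hcast.comp (h.measurable k)).sub_const _).const_mul _
  have hind : ProbabilityTheory.iIndepFun (fun k ω => (ε k : ℝ) * ((ξ k ω : ℝ) - p)) μ :=
    h.indep.comp (fun k n => (ε k : ℝ) * ((n : ℝ) - p)) fun k => (hcast.sub_const _).const_mul _
  have := hind.mgf_sum (t := θ) hm s
  simp only [ProbabilityTheory.mgf, Finset.sum_apply] at this
  unfold centeredSum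
  rw [this]
  refine Finset.prod_congr rfl fun k hk => ?_
  rw [integral_comp_of_mem_finset (h.measurable k) {0, 1}
    (fun ω => by simpa using h.zero_or_one k ω)
    (fun n => Real.exp (θ * ((ε k : ℝ) * ((n : ℝ) - p))))]
  rw [Finset.sum_pair (by norm_num), h.prob_zero hk, h.prob k hk, centeredMGF]
  push_cast
  ring_nf

/-- Taylor expansion of the exponential at both values: centering removes the linear term, and the
quadratic term is the variance p(1-p). -/
lemma abs_centeredMGF_sub_le (hp0 : 0 ≤ p) (hp1 : p ≤ 1) {θ : ℝ} (hθ : |θ| ≤ 1 / 2) :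
    |centeredMGF p θ - (1 + p * (1 - p) * θ ^ 2 / 2)| ≤ |θ| ^ 3 / 4 := by
  have key : ∀ y, |y| ≤ 1 → |Real.exp (θ * y) - (1 + θ * y + (θ * y) ^ 2 / 2)| ≤ |θ| ^ 3 / 4 := by
    intro y hy
    have h1 : |θ * y| ≤ |θ| := by
      rw [abs_mul]; exact mul_le_of_le_one_right (abs_nonneg _) hy
    have h2 := Real.exp_bound (x := θ * y) (by linarith) (n := 3) (by norm_num)
    simp only [Finset.sum_range_succ, Finset.sum_range_zero, Nat.factorial] at h2
    norm_num at h2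
    have h3 : |θ * y| ^ 3 ≤ |θ| ^ 3 := by gcongr
    calc _ ≤ |θ * y| ^ 3 * (2 / 9) := by convert h2 using 2; rw [abs_mul]
      _ ≤ |θ| ^ 3 / 4 := by
        have : 0 ≤ |θ| ^ 3 := by positivity
        linarith
  have k1 := key (1 - p) (by rw [abs_le]; constructor <;> linarith)
  have k2 := key (0 - p) (by rw [abs_le]; constructor <;> linarith)
  have e : centeredMGF p θ - (1 + p * (1 - p) * θ ^ 2 / 2) =
      p * (Real.exp (θ * (1 - p)) - (1 + θ * (1 - p) + (θ * (1 - p)) ^ 2 / 2)) +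
      (1 - p) * (Real.exp (θ * (0 - p)) - (1 + θ * (0 - p) + (θ * (0 - p)) ^ 2 / 2)) := by
    unfold centeredMGF; ring
  rw [e]
  refine (abs_add_le _ _).trans ?_
  rw [abs_mul, abs_mul, abs_of_nonneg hp0, abs_of_nonneg (by linarith : 0 ≤ 1 - p)]
  nlinarith [mul_le_mul_of_nonneg_left k1 hp0,
    mul_le_mul_of_nonneg_left k2 (by linarith : 0 ≤ 1 - p)]

lemma centeredMGF_le (hp0 : 0 ≤ p) (hp1 : p ≤ 1) {θ : ℝ} (hθ : |θ| ≤ 1 / 2) :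
    centeredMGF p θ ≤ Real.exp (p * (1 - p) * θ ^ 2 / 2 + 2 * |θ| ^ 3) := by
  have h := (abs_le.1 (abs_centeredMGF_sub_le hp0 hp1 hθ)).2
  have h2 := Real.add_one_le_exp (p * (1 - p) * θ ^ 2 / 2 + 2 * |θ| ^ 3)
  have : 0 ≤ |θ| ^ 3 := by positivity
  linarith

/-- By exp z ≤ 1 + z + z² with z the exponent: here z² ≤ |θ|³/2, and the generous cubic term 2|θ|³
absorbs both this and the Taylor error. -/
lemma le_centeredMGF (hp0 : 0 ≤ p) (hp1 : p ≤ 1) {θ : ℝ} (hθ : |θ| ≤ 1 / 2) :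
    Real.exp (p * (1 - p) * θ ^ 2 / 2 - 2 * |θ| ^ 3) ≤ centeredMGF p θ := by
  have h := (abs_le.1 (abs_centeredMGF_sub_le hp0 hp1 hθ)).1
  rw [← sq_abs θ] at h ⊢
  set t := |θ| with ht
  have ht0 : 0 ≤ t := abs_nonneg _
  have hv0 : 0 ≤ p * (1 - p) := mul_nonneg hp0 (by linarith)
  have hv1 : p * (1 - p) ≤ 1 / 4 := by nlinarith [sq_nonneg (p - 1 / 2)]
  set v := p * (1 - p)
  set z := v * t ^ 2 / 2 - 2 * t ^ 3 with hz
  have t2 : 0 ≤ t ^ 2 := by positivity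
  have t3 : t ^ 3 ≤ t ^ 2 / 2 := by nlinarith
  have t30 : 0 ≤ t ^ 3 := by positivity
  have vt : v * t ^ 2 ≤ t ^ 2 / 4 := by nlinarith
  have vt0 : 0 ≤ v * t ^ 2 := by positivity
  have hzabs : |z| ≤ t ^ 2 := by rw [abs_le]; constructor <;> linarith
  have hz1 : |z| ≤ 1 := by nlinarith
  have hexp := (abs_le.1 (Real.abs_exp_sub_one_sub_id_le hz1)).2
  have hzsq : z ^ 2 ≤ t ^ 3 / 2 := by
    have : z ^ 2 ≤ (t ^ 2) ^ 2 := by rw [← sq_abs z]; gcongr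
    nlinarith
  linarith

lemma prod_centeredMGF_le (hp0 : 0 ≤ p) (hp1 : p ≤ 1) (ε : ι → ℤ)
    (hε : ∀ k, ε k = 1 ∨ ε k = -1) {θ : ℝ} (hθ : |θ| ≤ 1 / 2) :
    ∏ k ∈ s, centeredMGF p (ε k * θ) ≤
      Real.exp (s.card * (p * (1 - p) * θ ^ 2 / 2 + 2 * |θ| ^ 3)) := by
  rw [← nsmul_eq_mul, ← Finset.sum_const, Real.exp_sum]
  refine Finset.prod_le_prod (fun k _ => ?_) fun k _ => ?_
  · unfold centeredMGF
    have : 0 ≤ 1 - p := by linarith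
    positivity
  · have ha : |(ε k : ℝ) * θ| = |θ| := by rcases hε k with h | h <;> simp [h]
    have h := centeredMGF_le hp0 hp1 (θ := ε k * θ) (by rwa [ha])
    rw [ha] at h
    rwa [← sq_abs (_ * θ), ha, sq_abs] at h

lemma le_prod_centeredMGF (hp0 : 0 ≤ p) (hp1 : p ≤ 1) (ε : ι → ℤ)
    (hε : ∀ k, ε k = 1 ∨ ε k = -1) {θ : ℝ} (hθ : |θ| ≤ 1 / 2) :
    Real.exp (s.card * (p * (1 - p) * θ ^ 2 / 2 - 2 * |θ| ^ 3)) ≤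
      ∏ k ∈ s, centeredMGF p (ε k * θ) := by
  rw [← nsmul_eq_mul, ← Finset.sum_const, Real.exp_sum]
  refine Finset.prod_le_prod (fun k _ => (Real.exp_pos _).le) fun k _ => ?_
  have ha : |(ε k : ℝ) * θ| = |θ| := by rcases hε k with h | h <;> simp [h]
  have h := le_centeredMGF hp0 hp1 (θ := ε k * θ) (by rwa [ha])
  rw [ha] at h
  rwa [← sq_abs (_ * θ), ha, sq_abs] at h

omit [MeasurableSpace Ω] in
lemma centeredSum_eq (ε : ι → ℤ) (ω : Ω) :
    centeredSum ξ p ε s ω = ((∑ k ∈ s, ε k * ξ k ω : ℤ) : ℝ) - ∑ k ∈ s, (ε k : ℝ) * p := by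
  unfold centeredSum
  push_cast
  rw [← Finset.sum_sub_distrib]
  exact Finset.sum_congr rfl fun k _ => by ring

lemma signed_sum_mem_Icc (h : BernoulliFamily μ ξ s p) (ε : ι → ℤ)
    (hε : ∀ k, ε k = 1 ∨ ε k = -1) (ω : Ω) :
    ∑ k ∈ s, ε k * ξ k ω ∈ Finset.Icc (-(s.card : ℤ)) s.card := by
  rw [Finset.mem_Icc, ← abs_le]
  refine (Finset.abs_sum_le_sum_abs _ _).trans ?_
  refine (Finset.sum_le_card_nsmul s _ 1 fun k _ => ?_).trans (by simp)
  rcases hε k with h1 | h1 <;> rcases h.zero_or_one k ω with h2 | h2 <;> simp [h1, h2]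

lemma abs_centeredSum_le (h : BernoulliFamily μ ξ s p) (hp0 : 0 ≤ p) (hp1 : p ≤ 1) (ε : ι → ℤ)
    (hε : ∀ k, ε k = 1 ∨ ε k = -1) (ω : Ω) : |centeredSum ξ p ε s ω| ≤ s.card := by
  unfold centeredSum
  refine (Finset.abs_sum_le_sum_abs _ _).trans ?_
  refine (Finset.sum_le_card_nsmul s _ 1 fun k _ => ?_).trans (by simp)
  have : |(ξ k ω : ℝ) - p| ≤ 1 := by
    rcases h.zero_or_one k ω with h2 | h2 <;> rw [h2, abs_le] <;> push_cast <;>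
      constructor <;> linarith
  rcases hε k with h1 | h1 <;> rw [h1, abs_mul] <;> simpa using this

/-! ### Tail bounds for centered signed sums -/

/-- Chernoff bound for a centered signed sum. -/
lemma tail_upper [IsProbabilityMeasure μ] (h : BernoulliFamily μ ξ s p) (hp0 : 0 ≤ p)
    (hp1 : p ≤ 1) (ε : ι → ℤ) (hε : ∀ k, ε k = 1 ∨ ε k = -1) {θ : ℝ} (hθ0 : 0 ≤ θ)
    (hθ : θ ≤ 1 / 2) (t : ℝ) :
    μ.real {ω | t ≤ centeredSum ξ p ε s ω} ≤
      Real.exp (-θ * t + s.card * (p * (1 - p) * θ ^ 2 / 2 + 2 * θ ^ 3)) := by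
  have hm := h.measurable_centeredSum ε s
  have hint : Integrable (fun ω => Real.exp (θ * centeredSum ξ p ε s ω)) μ := by
    refine Integrable.of_bound (hm.const_mul θ).exp.aestronglyMeasurable
      (Real.exp (θ * s.card)) (Filter.Eventually.of_forall fun ω => ?_)
    rw [Real.norm_eq_abs, abs_of_pos (Real.exp_pos _), Real.exp_le_exp]
    exact mul_le_mul_of_nonneg_left
      ((le_abs_self _).trans (h.abs_centeredSum_le hp0 hp1 ε hε ω)) hθ0
  refine (ProbabilityTheory.measure_ge_le_exp_mul_mgf t hθ0 hint).trans ?_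
  rw [Real.exp_add]
  refine mul_le_mul_of_nonneg_left ?_ (Real.exp_pos _).le
  unfold ProbabilityTheory.mgf
  rw [h.mgf_centeredSum ε θ]
  have := prod_centeredMGF_le (s := s) hp0 hp1 ε hε (θ := θ) (by rwa [abs_of_nonneg hθ0])
  rwa [abs_of_nonneg hθ0] at this

/-- Lower bound for the tail of a centered signed sum in the range of moderate deviations. -/
lemma tail_lower [IsProbabilityMeasure μ] (h : BernoulliFamily μ ξ s p) (hp0 : 0 ≤ p)
    (hp1 : p ≤ 1) (ε : ι → ℤ) (hε : ∀ k, ε k = 1 ∨ ε k = -1) {l σ : ℝ} (hl : 1 ≤ l)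
    (hσ : σ ^ 2 = p * (1 - p) * s.card) (hlσ : 2 * (l + 10) ≤ σ)
    (herr : 2 * s.card * (l + 10) ^ 3 ≤ σ ^ 3 / 10) :
    Real.exp (-12) / (20 * l) * Real.exp (-l ^ 2 / 2) ≤
      μ.real {ω | l * σ < centeredSum ξ p ε s ω} := by
  have hσ0 : 0 < σ := by linarith
  set m : ℝ := ∑ k ∈ s, (ε k : ℝ) * p with hm
  set Z : Ω → ℤ := fun ω => ∑ k ∈ s, ε k * ξ k ω with hZ
  have hZm : Measurable Z := h.measurable_signed_sum ε s
  set T := Finset.Icc (-(s.card : ℤ)) s.card with hT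
  have hZT : ∀ ω, Z ω ∈ T := fun ω => h.signed_sum_mem_Icc ε hε ω
  set a : ℤ → ℝ := fun n => μ.real {ω | Z ω = n} with ha
  have hmgf : ∀ u : ℝ, ∑ n ∈ T, a n * Real.exp (u * ((n - m) / σ)) =
      ∏ k ∈ s, centeredMGF p (ε k * (u / σ)) := fun u => by
    rw [← h.mgf_centeredSum ε (u / σ),
      ← integral_comp_of_mem_finset hZm T hZT fun n => Real.exp (u * ((n - m) / σ))]
    congr 1
    ext ω
    rw [centeredSum_eq]
    congr 1
    field_simp
    rfl
  -- At θ = u/σ the quadratic exponent is exactly u²/2 and the total cubic error is at most 1/10. As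
  -- e^(-1/10) ≥ 9/10, this gives the factors 9/10 and 10/9.
  have hbd : ∀ u : ℝ, |u| ≤ l + 10 → |u / σ| ≤ 1 / 2 ∧
      (s.card : ℝ) * (2 * |u / σ| ^ 3) ≤ 1 / 10 ∧
      s.card * (p * (1 - p) * (u / σ) ^ 2 / 2) = u ^ 2 / 2 := fun u hu => by
    have e : |u / σ| = |u| / σ := by rw [abs_div, abs_of_pos hσ0]
    refine ⟨?_, ?_, ?_⟩
    · rw [e, div_le_iff₀ hσ0]; linarith
    · rw [e, div_pow]
      have h3 : |u| ^ 3 ≤ (l + 10) ^ 3 := by gcongr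
      have hc : (0 : ℝ) ≤ s.card := by positivity
      rw [← mul_div_assoc, ← mul_div_assoc, div_le_iff₀ (by positivity)]
      nlinarith
    · rw [div_pow, hσ]
      have : p * (1 - p) * s.card ≠ 0 := by rw [← hσ]; positivity
      calc _ = p * (1 - p) * s.card * (u ^ 2 / (p * (1 - p) * s.card)) / 2 := by ring
        _ = _ := by rw [mul_div_cancel₀ _ this]
  have hlow := (h.strongLogConcave_pmf hp0 hp1 ε hε).tail_lower (fun n => measureReal_nonneg)
    T (m := m) (σ := σ) (l := l) ?_ hl (by linarith) ?_ ?_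
  · refine hlow.trans (le_of_eq ?_)
    have hset : MeasurableSet {ω | l * σ < centeredSum ξ p ε s ω} :=
      measurableSet_lt measurable_const (h.measurable_centeredSum ε s)
    have h1 := integral_comp_of_mem_finset (μ := μ) hZm T hZT
      fun n => if l < ((n : ℝ) - m) / σ then (1 : ℝ) else 0
    rw [Finset.sum_filter]
    simp only [mul_ite, mul_one, mul_zero] at h1
    rw [← h1, ← integral_indicator_one hset]
    congr 1
    ext ω
    rw [Set.indicator_apply]
    have : (l < ((Z ω : ℝ) - m) / σ) ↔ (ω ∈ {ω | l * σ < centeredSum ξ p ε s ω}) := by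
      rw [Set.mem_ofPred_eq, centeredSum_eq, lt_div_iff₀ hσ0]
    simp only [this]
    rfl
  · intro n hn
    have : {ω | Z ω = n} = ∅ := by
      ext ω
      simp only [Set.mem_ofPred_eq, Set.mem_empty_iff_false, iff_false]
      exact fun h => hn (h ▸ hZT ω)
    change μ.real {ω | Z ω = n} = 0
    rw [this, measureReal_empty]
  · intro u hu
    obtain ⟨b1, b2, b3⟩ := hbd u hu
    have := le_prod_centeredMGF (s := s) hp0 hp1 ε hε b1
    rw [mul_sub, b3] at this
    refine le_trans ?_ (this.trans (hmgf u).ge)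
    rw [sub_eq_add_neg, Real.exp_add, mul_comm]
    refine mul_le_mul_of_nonneg_left ?_ (Real.exp_pos _).le
    have := Real.add_one_le_exp (-((s.card : ℝ) * (2 * |u / σ| ^ 3)))
    linarith
  · intro u hu
    obtain ⟨b1, b2, b3⟩ := hbd u hu
    have := prod_centeredMGF_le (s := s) hp0 hp1 ε hε b1
    rw [mul_add, b3] at this
    refine le_trans ((hmgf u).le.trans this) ?_
    rw [Real.exp_add, mul_comm]
    refine mul_le_mul_of_nonneg_right ?_ (Real.exp_pos _).le
    have h1 := Real.add_one_le_exp (-((s.card : ℝ) * (2 * |u / σ| ^ 3)))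
    rw [Real.exp_neg] at h1
    have h2 := Real.exp_pos ((s.card : ℝ) * (2 * |u / σ| ^ 3))
    have h3 : 9 / 10 ≤ (Real.exp ((s.card : ℝ) * (2 * |u / σ| ^ 3)))⁻¹ := by linarith
    have h4 := (le_inv_comm₀ (by norm_num) h2).1 h3
    linarith

/-- Hoeffding bound for a centered signed sum. -/
lemma hoeffding [IsProbabilityMeasure μ] (h : BernoulliFamily μ ξ s p) (ε : ι → ℤ)
    (hε : ∀ k, ε k = 1 ∨ ε k = -1) {t : ℝ} (ht : 0 ≤ t) :
    μ.real {ω | t ≤ centeredSum ξ p ε s ω} ≤ Real.exp (-t ^ 2 / (2 * s.card)) := by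
  have hcast : Measurable (fun n : ℤ => (n : ℝ)) := measurable_from_top
  have hm : ∀ k, Measurable fun ω => (ε k : ℝ) * (ξ k ω : ℝ) := fun k =>
    (hcast.comp (h.measurable k)).const_mul _
  have hind : ProbabilityTheory.iIndepFun (fun k ω => (ε k : ℝ) * ((ξ k ω : ℝ) - p)) μ :=
    h.indep.comp (fun k n => (ε k : ℝ) * ((n : ℝ) - p)) fun k => (hcast.sub_const _).const_mul _
  have hsub : ∀ k ∈ s, ProbabilityTheory.HasSubgaussianMGF
      (fun ω => (ε k : ℝ) * ((ξ k ω : ℝ) - p)) 1 μ := fun k hk => by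
    -- The interval [-1, 1] serves both signs at once, at the price of the variance proxy 1 instead
    -- of 1/4.
    have h1 := ProbabilityTheory.hasSubgaussianMGF_of_mem_Icc (μ := μ) (a := -1) (b := 1)
      (hm k).aemeasurable (Filter.Eventually.of_forall fun ω => by
        rcases hε k with h1 | h1 <;> rcases h.zero_or_one k ω with h2 | h2 <;>
          norm_num [h1, h2])
    have h2 : ∫ ω, (ε k : ℝ) * (ξ k ω : ℝ) ∂μ = ε k * p := by
      rw [integral_comp_of_mem_finset (h.measurable k) {0, 1}
        (fun ω => by simpa using h.zero_or_one k ω) (fun n => (ε k : ℝ) * (n : ℝ))]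
      rw [Finset.sum_pair (by norm_num), h.prob k hk]
      push_cast; ring
    rw [h2] at h1
    convert h1 using 1
    · ext ω; ring
    · ext; norm_num
  have h3 := ProbabilityTheory.HasSubgaussianMGF.measure_sum_ge_le_of_iIndepFun hind
    (c := fun _ => 1) hsub ht
  simpa [centeredSum] using h3

end BernoulliFamily

/-! ### The links of the random graphs -/

lemma iIndepFun_map {Ω Ω' ι : Type*} {β : ι → Type*} [MeasurableSpace Ω] [MeasurableSpace Ω']
    {m : ∀ i, MeasurableSpace (β i)} {ν : Measure Ω} {T : Ω → Ω'} (hT : Measurable T)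
    {X : ∀ i, Ω' → β i} (hX : ∀ i, Measurable (X i))
    (h : ProbabilityTheory.iIndepFun (fun i ω => X i (T ω)) ν) :
    ProbabilityTheory.iIndepFun X (ν.map T) := by
  rw [ProbabilityTheory.iIndepFun_iff_measure_inter_preimage_eq_mul] at h ⊢
  intro S sets H
  have e : ∀ i ∈ S, ν.map T (X i ⁻¹' sets i) = ν ((fun ω => X i (T ω)) ⁻¹' sets i) :=
    fun i hi => Measure.map_apply hT (hX i (H i hi))
  rw [Finset.prod_congr rfl e, ← h S H,
    Measure.map_apply hT (S.measurableSet_biInter fun i hi => hX i (H i hi))]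
  congr 1
  ext ω
  simp

open Classical in
/-- The indicator of a link in a graph. -/
noncomputable def linkIndicator {V : Type*} (e : Sym2 V) (g : SimpleGraph V) : ℤ :=
  if e ∈ g.edgeSet then 1 else 0

lemma measurable_linkIndicator {V : Type*} (e : Sym2 V) :
    Measurable (linkIndicator e : SimpleGraph V → ℤ) := by
  unfold linkIndicator
  refine Measurable.ite ?_ measurable_const measurable_const
  have := (measurable_set_iff.1 (SimpleGraph.measurable_edgeSet (V := V))) e
  exact measurableSet_setOfPred.2 this

section BinomialRandom

variable {V : Type*} [Countable V]

/-- As an image of a product measure, the random graph has independent links because the coordinates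
are independent. On the diagonal both Dirac masses sit at `False`. -/
lemma binomialRandom_eq_map_infinitePi (p : unitInterval) :
    G(V, p) = (Measure.infinitePi fun e : Sym2 V =>
      (unitInterval.toNNReal p • Measure.dirac (e ∈ (Sym2.diagSetᶜ : Set (Sym2 V))) +
        unitInterval.toNNReal (unitInterval.symm p) • Measure.dirac False : Measure Prop)).map
          fun f => SimpleGraph.fromEdgeSet {e | f e} := by
  rw [SimpleGraph.binomialRandom_eq_map, ProbabilityTheory.setBernoulli_eq_map]
  exact Measure.map_map SimpleGraph.measurable_fromEdgeSet MeasurableEquiv.setOfPred.measurable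

omit [Countable V] in
lemma measurable_fromEdgeSet_setOf :
    Measurable fun f : Sym2 V → Prop => SimpleGraph.fromEdgeSet {e | f e} :=
  SimpleGraph.measurable_fromEdgeSet.comp MeasurableEquiv.setOfPred.measurable

omit [Countable V] in
open Classical in
lemma linkIndicator_fromEdgeSet (e : Sym2 V) (f : Sym2 V → Prop) :
    linkIndicator e (SimpleGraph.fromEdgeSet {e | f e}) = if f e ∧ ¬ e.IsDiag then 1 else 0 := by
  unfold linkIndicator
  simp [SimpleGraph.edgeSet_fromEdgeSet]

lemma iIndepFun_linkIndicator (p : unitInterval) :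
    ProbabilityTheory.iIndepFun (fun e : Sym2 V => (linkIndicator e : SimpleGraph V → ℤ))
      G(V, p) := by
  classical
  rw [binomialRandom_eq_map_infinitePi]
  refine iIndepFun_map measurable_fromEdgeSet_setOf measurable_linkIndicator ?_
  simp_rw [linkIndicator_fromEdgeSet]
  exact ProbabilityTheory.iIndepFun_infinitePi (X := fun (e : Sym2 V) (q : Prop) =>
    if q ∧ ¬ e.IsDiag then (1 : ℤ) else 0) fun e => measurable_from_top

lemma prob_linkIndicator (p : unitInterval) {e : Sym2 V} (he : ¬ e.IsDiag) :
    G(V, p).real {g | linkIndicator e g = 1} = p := by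
  classical
  have hme : MeasurableSet {g : SimpleGraph V | linkIndicator e g = 1} :=
    measurable_linkIndicator e (measurableSet_singleton 1)
  rw [binomialRandom_eq_map_infinitePi, map_measureReal_apply measurable_fromEdgeSet_setOf hme]
  have h1 : (fun f : Sym2 V → Prop => SimpleGraph.fromEdgeSet {e | f e}) ⁻¹'
      {g | linkIndicator e g = 1} = (fun f : Sym2 V → Prop => f e) ⁻¹' {True} := by
    ext f
    simp [linkIndicator_fromEdgeSet, he]
  rw [h1, ← map_measureReal_apply (measurable_pi_apply e) (measurableSet_singleton _),
    Measure.infinitePi_map_eval]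
  have : (e ∈ (Sym2.diagSetᶜ : Set (Sym2 V))) = True := by simpa using he
  rw [this, measureReal_def]
  simp

end BinomialRandom

section GraphProcess

variable (M K : ℕ) (p : unitInterval)

/-- The law of the link graphs at the `K` time steps. -/
noncomputable def graphLaw : Measure (Fin K → SimpleGraph (Fin M)) :=
  Measure.pi fun _ : Fin K => G(Fin M, p)

instance : IsProbabilityMeasure (graphLaw M K p) := by
  unfold graphLaw; infer_instance

/-- Independence across time steps comes from the product measure and independence across pairs from
the random graph at each step; uncurrying joins the two. -/
lemma iIndepFun_links :
    ProbabilityTheory.iIndepFun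
      (fun (k : Fin K × Sym2 (Fin M)) (g : Fin K → SimpleGraph (Fin M)) =>
        linkIndicator k.2 (g k.1)) (graphLaw M K p) := by
  refine ProbabilityTheory.iIndepFun_uncurry'
    (X := fun (t : Fin K) (e : Sym2 (Fin M)) (g : Fin K → SimpleGraph (Fin M)) =>
      linkIndicator e (g t)) ?_ ?_ ?_
  · exact fun t e => (measurable_linkIndicator e).comp (measurable_pi_apply t)
  · unfold graphLaw
    refine ProbabilityTheory.iIndepFun_pi (X := fun (t : Fin K) (h : SimpleGraph (Fin M)) =>
      fun e => linkIndicator e h) fun t => ?_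
    exact (measurable_pi_iff.2 fun e => measurable_linkIndicator e).aemeasurable
  · intro t
    have h := iIndepFun_linkIndicator (V := Fin M) p
    have e : G(Fin M, p) = (graphLaw M K p).map (Function.eval t) :=
      ((measurePreserving_eval (fun _ : Fin K => G(Fin M, p)) t).map_eq).symm
    rw [e, ProbabilityTheory.iIndepFun_iff_measure_inter_preimage_eq_mul] at h
    rw [ProbabilityTheory.iIndepFun_iff_measure_inter_preimage_eq_mul]
    intro S sets H
    have h' := h S H
    rw [Measure.map_apply (measurable_pi_apply t)
      (S.measurableSet_biInter fun i hi => measurable_linkIndicator i (H i hi))] at h'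
    have e2 : ∀ i ∈ S, (graphLaw M K p).map (Function.eval t) (linkIndicator i ⁻¹' sets i) =
        graphLaw M K p ((fun g => linkIndicator i (g t)) ⁻¹' sets i) := fun i hi =>
      Measure.map_apply (measurable_pi_apply t) (measurable_linkIndicator i (H i hi))
    rw [Finset.prod_congr rfl e2] at h'
    rw [← h']
    congr 1
    ext ω
    simp

/-- The links, over all time steps and all pairs of distinct users. -/
lemma bernoulliFamily_links (s : Finset (Fin K × Sym2 (Fin M))) (hs : ∀ k ∈ s, ¬ k.2.IsDiag) :
    BernoulliFamily (graphLaw M K p) (fun k g => linkIndicator k.2 (g k.1)) s p where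
  measurable k := (measurable_linkIndicator k.2).comp (measurable_pi_apply k.1)
  indep := iIndepFun_links M K p
  zero_or_one k ω := by
    unfold linkIndicator
    split_ifs <;> simp
  prob k hk := by
    have h := prob_linkIndicator (V := Fin M) p (hs k hk)
    rw [← h]
    have e : G(Fin M, p) = (graphLaw M K p).map (Function.eval k.1) :=
      ((measurePreserving_eval (fun _ : Fin K => G(Fin M, p)) k.1).map_eq).symm
    have hme : MeasurableSet {g : SimpleGraph (Fin M) | linkIndicator k.2 g = 1} :=
      measurable_linkIndicator k.2 (measurableSet_singleton 1)
    rw [e, map_measureReal_apply (measurable_pi_apply k.1) hme]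
    rfl

end GraphProcess

namespace BernoulliFamily

variable {Ω ι κ : Type*} [MeasurableSpace Ω] {μ : Measure Ω} {ξ : ι → Ω → ℤ} {p : ℝ}

lemma precomp {f : κ → ι} (hf : f.Injective) {s : Finset κ}
    (h : BernoulliFamily μ ξ (s.map ⟨f, hf⟩) p) : BernoulliFamily μ (fun k => ξ (f k)) s p :=
  ⟨fun k => h.measurable (f k), h.indep.precomp hf, fun k => h.zero_or_one (f k),
    fun k hk => h.prob (f k) (Finset.mem_map_of_mem _ hk)⟩

end BernoulliFamily

/-- Events that depend on disjoint blocks of an independent family are independent. -/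
lemma iIndepFun_blocks {Ω ι J : Type*} [MeasurableSpace Ω] {μ : Measure Ω} {ξ : ι → Ω → ℤ}
    (hm : ∀ k, Measurable (ξ k)) (h : ProbabilityTheory.iIndepFun ξ μ)
    (I : Finset J) (B : J → Finset ι)
    (hB : ∀ i ∈ I, ∀ j ∈ I, i ≠ j → Disjoint (B i) (B j)) (Q : J → (ι → ℤ) → Prop)
    (hQ : ∀ i x y, (∀ k ∈ B i, x k = y k) → (Q i x ↔ Q i y)) :
    μ.real {ω | ∀ i ∈ I, Q i fun k => ξ k ω} = ∏ i ∈ I, μ.real {ω | Q i fun k => ξ k ω} := by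
  classical
  have := h.isProbabilityMeasure
  induction I using Finset.induction_on with
  | empty => simp
  | insert i I hi ih =>
    rw [Finset.prod_insert hi, ← ih fun i hi j hj =>
      hB i (Finset.mem_insert_of_mem hi) j (Finset.mem_insert_of_mem hj)]
    set S := B i
    set T := I.biUnion B with hT
    have hST : Disjoint S T := by
      rw [hT, Finset.disjoint_biUnion_right]
      exact fun j hj => hB i (Finset.mem_insert_self _ _) j (Finset.mem_insert_of_mem hj)
        fun e => hi (e ▸ hj)
    have hind := h.indepFun_finset S T hST hm
    -- Values outside the block are filled with 0; the choice is irrelevant because `Q` looks only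
    -- at its block.
    let ext (U : Finset ι) (x : U → ℤ) (k : ι) : ℤ := if hk : k ∈ U then x ⟨k, hk⟩ else 0
    have hext : ∀ (U : Finset ι) (ω : Ω), ∀ k ∈ U, ext U (fun l : U => ξ l ω) k = ξ k ω :=
      fun U ω k hk => by simp [ext, hk]
    have h1 := hind.measure_inter_preimage_eq_mul {x | Q i (ext S x)}
      {x | ∀ j ∈ I, Q j (ext T x)} .of_discrete .of_discrete
    have e1 : (fun a (l : S) => ξ l a) ⁻¹' {x | Q i (ext S x)} = {ω | Q i fun k => ξ k ω} := by
      ext ω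
      exact hQ i _ _ (hext S ω)
    have e2 : (fun a (l : T) => ξ l a) ⁻¹' {x | ∀ j ∈ I, Q j (ext T x)} =
        {ω | ∀ j ∈ I, Q j fun k => ξ k ω} := by
      ext ω
      refine forall₂_congr fun j hj => hQ j _ _ fun k hk => hext T ω k ?_
      exact Finset.mem_biUnion.2 ⟨j, hj, hk⟩
    rw [e1, e2] at h1
    simp only [measureReal_def, ← ENNReal.toReal_mul]
    rw [← h1]
    congr 2
    ext ω
    simp

/-! ### The noise of the links for fixed local decisions -/

namespace BernoulliFamily

/-- The exponent grows with the cardinality. An empty index set needs separate care: division by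
zero would make Hoeffding's bound equal to 1, but the event is empty because t > 0. -/
lemma hoeffding_of_card_le {Ω ι : Type*} [MeasurableSpace Ω] {μ : Measure Ω} {ξ : ι → Ω → ℤ}
    {s : Finset ι} {p : ℝ} [IsProbabilityMeasure μ] (h : BernoulliFamily μ ξ s p) (ε : ι → ℤ)
    (hε : ∀ k, ε k = 1 ∨ ε k = -1) {t n : ℝ} (ht : 0 < t) (hn : (s.card : ℝ) ≤ n) :
    μ.real {ω | t ≤ centeredSum ξ p ε s ω} ≤ Real.exp (-t ^ 2 / (2 * n)) := by
  rcases s.eq_empty_or_nonempty with rfl | hs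
  · have : {ω : Ω | t ≤ centeredSum ξ p ε ∅ ω} = ∅ := by
      ext ω
      simp [centeredSum, ht]
    rw [this, measureReal_empty]
    positivity
  · have hc : (0 : ℝ) < s.card := by exact_mod_cast hs.card_pos
    refine (h.hoeffding ε hε ht.le).trans (Real.exp_le_exp.2 ?_)
    rw [neg_div, neg_div, neg_le_neg_iff]
    gcongr

end BernoulliFamily

section Noise

variable {M K : ℕ}

/-- The indices of the links between `i` and the users in `A` that do not censor. -/
def noiseIndex (K : ℕ) (b : Fin M → ℤ) (i : Fin M) (A : Finset (Fin M)) :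
    Finset (Fin K × Fin M) :=
  Finset.univ ×ˢ A.filter fun j => j ≠ i ∧ b j ≠ 0

/-- The signs with which the links enter the noise. -/
def noiseSign (K : ℕ) (b : Fin M → ℤ) (k : Fin K × Fin M) : ℤ :=
  if b k.2 = 0 then 1 else -b k.2

/-- The links of the user `i`. -/
noncomputable def userLink (i : Fin M) (k : Fin K × Fin M) (g : Fin K → SimpleGraph (Fin M)) : ℤ :=
  linkIndicator s(i, k.2) (g k.1)

/-- The random part of the consensus statistic of user `i` that is due to the users in `A`,
with the opposite sign. -/
noncomputable def linkNoise (p : ℝ) (b : Fin M → ℤ) (i : Fin M) (A : Finset (Fin M))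
    (g : Fin K → SimpleGraph (Fin M)) : ℝ :=
  BernoulliFamily.centeredSum (userLink i) p (noiseSign K b) (noiseIndex K b i A) g

/-- The default sign 1 at censoring users, who do not occur in `noiseIndex`, makes every sign ±1, as
the tail bounds require. -/
lemma noiseSign_eq {b : Fin M → ℤ} (hb : ∀ j, b j = 1 ∨ b j = 0 ∨ b j = -1) (k : Fin K × Fin M) :
    noiseSign K b k = 1 ∨ noiseSign K b k = -1 := by
  unfold noiseSign
  rcases hb k.2 with h | h | h <;> simp [h]

lemma injective_pair_edge (i : Fin M) :
    Function.Injective fun k : Fin K × Fin M => (k.1, s(i, k.2)) := by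
  rintro ⟨t, j⟩ ⟨t', j'⟩ h
  simp only [Prod.mk.injEq, Sym2.congr_right] at h
  rw [h.1, h.2]

lemma bernoulliFamily_userLink (p : unitInterval) (b : Fin M → ℤ) (i : Fin M)
    (A : Finset (Fin M)) :
    BernoulliFamily (graphLaw M K p) (userLink i) (noiseIndex K b i A) (p : ℝ) := by
  refine BernoulliFamily.precomp (injective_pair_edge i)
    (ξ := fun (k : Fin K × Sym2 (Fin M)) (g : Fin K → SimpleGraph (Fin M)) =>
      linkIndicator k.2 (g k.1))
    (bernoulliFamily_links M K p _ fun k hk => ?_)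
  obtain ⟨l, hl, rfl⟩ := Finset.mem_map.1 hk
  simp only [noiseIndex, Finset.mem_product, Finset.mem_filter] at hl
  simpa using hl.2.2.1.symm

lemma linkNoise_eq (p : ℝ) (b : Fin M → ℤ) (i : Fin M) (A : Finset (Fin M))
    (g : Fin K → SimpleGraph (Fin M)) :
    linkNoise p b i A g = -∑ t : Fin K, ∑ j ∈ A with j ≠ i,
      (b j : ℝ) * ((linkIndicator s(i, j) (g t) : ℝ) - p) := by
  unfold linkNoise BernoulliFamily.centeredSum noiseIndex
  rw [Finset.sum_product, ← Finset.sum_neg_distrib]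
  refine Finset.sum_congr rfl fun t _ => ?_
  rw [← Finset.filter_filter, Finset.sum_filter, ← Finset.sum_neg_distrib]
  refine Finset.sum_congr rfl fun j _ => ?_
  unfold noiseSign userLink
  by_cases h : b j = 0
  · simp [h]
  · simp [h]

lemma linkNoise_add_compl (p : ℝ) (b : Fin M → ℤ) (i : Fin M) (A : Finset (Fin M))
    (g : Fin K → SimpleGraph (Fin M)) :
    linkNoise p b i A g + linkNoise p b i Aᶜ g = linkNoise p b i Finset.univ g := by
  simp only [linkNoise_eq, ← neg_add, ← Finset.sum_add_distrib]
  congr 2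
  ext t
  rw [← Finset.sum_union]
  · rw [← Finset.filter_union, Finset.union_compl]
  · exact Finset.disjoint_filter_filter disjoint_compl_right

lemma sentDecisions_eq (b : Fin M → ℝ) (k : ℕ) : CRN.sentDecisions b k = b := by
  induction k with
  | zero => rfl
  | succ k ih => exact ih

/-- The user's own decision supplies the term missing from the diagonal of the adjacency matrix, so
the statistic is a positive multiple of K p S minus the centered noise, with S the full sum. -/
lemma finalDecision_eq_one_iff {p : ℝ} (hp : 0 < p) (hK : 1 ≤ K) (b : Fin M → ℤ)
    (g : Fin K → SimpleGraph (Fin M)) (i : Fin M) :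
    CRN.finalDecision p (fun j => (b j : ℝ)) g i = 1 ↔
      linkNoise p b i Finset.univ g ≤ K * p * ∑ j, (b j : ℝ) := by
  classical
  have hM : (0 : ℝ) < M := by
    have : 0 < M := i.pos
    exact_mod_cast this
  have hKp : (0 : ℝ) < K * p := by
    have : (0 : ℝ) < K := by exact_mod_cast hK
    positivity
  have hlink : ∑ t : Fin K, ((g t).adjMatrix ℝ *ᵥ fun j => (b j : ℝ)) i =
      K * p * ∑ j with j ≠ i, (b j : ℝ) - linkNoise p b i Finset.univ g := by
    rw [linkNoise_eq, sub_neg_eq_add]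
    have e1 : (K : ℝ) * p * ∑ j with j ≠ i, (b j : ℝ) =
        ∑ _t : Fin K, ∑ j with j ≠ i, (b j : ℝ) * p := by
      rw [Finset.sum_const, Finset.card_univ, Fintype.card_fin, nsmul_eq_mul, ← Finset.sum_mul]
      ring
    rw [e1, ← Finset.sum_add_distrib]
    refine Finset.sum_congr rfl fun t _ => ?_
    rw [← Finset.sum_add_distrib, Matrix.mulVec, dotProduct, Finset.sum_filter]
    refine Finset.sum_congr rfl fun j _ => ?_
    unfold linkIndicator
    by_cases h : j = i
    · simp [h]
    · simp only [SimpleGraph.adjMatrix_apply, SimpleGraph.mem_edgeSet, ne_eq, h,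
        not_false_eq_true, if_true]
      split_ifs <;> push_cast <;> ring
  have hS : ∑ j, (b j : ℝ) = b i + ∑ j with j ≠ i, (b j : ℝ) := by
    rw [← Finset.add_sum_erase _ _ (Finset.mem_univ i)]
    congr 2
    ext j
    simp
  have hy : CRN.consensusStatistic p (fun j => (b j : ℝ)) g i =
      1 / M * (1 / (K * p)) * (K * p * ∑ j, (b j : ℝ) - linkNoise p b i Finset.univ g) := by
    unfold CRN.consensusStatistic
    simp only [sentDecisions_eq, Pi.smul_apply, Pi.add_apply, smul_eq_mul, Finset.sum_apply]
    have e : 1 / (M : ℝ) * (b i + 1 / (K * p) *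
        ∑ t : Fin K, ((g t).adjMatrix ℝ *ᵥ fun j => (b j : ℝ)) i) =
        1 / M * (1 / (K * p)) * (K * p * ∑ j, (b j : ℝ) - linkNoise p b i Finset.univ g) := by
      rw [hlink, hS]
      field_simp
      ring
    rw [← e]
  unfold CRN.finalDecision CRN.dec
  have hc : 0 < 1 / (M : ℝ) * (1 / (K * p)) := by positivity
  have hiff : 0 ≤ CRN.consensusStatistic p (fun j => (b j : ℝ)) g i ↔
      linkNoise p b i Finset.univ g ≤ K * p * ∑ j, (b j : ℝ) := by
    rw [hy, mul_nonneg_iff_of_pos_left hc, sub_nonneg]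
  rw [← hiff]
  split_ifs with h <;> simp [h]

/-! ### Bounds for a unanimous decision at fixed local decisions -/

/-- The probability that all users decide `H1`, for fixed local decisions `b`. -/
noncomputable def passProb (K : ℕ) (p : unitInterval) (b : Fin M → ℤ) : ℝ :=
  (graphLaw M K p).real {g | ∀ i, CRN.finalDecision (p : ℝ) (fun j => (b j : ℝ)) g i = 1}

/-- The number of users that do not censor. -/
def activeCount (b : Fin M → ℤ) : ℕ := (Finset.univ.filter fun j => b j ≠ 0).card

lemma card_noiseIndex_le (b : Fin M → ℤ) (i : Fin M) (A : Finset (Fin M)) :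
    (noiseIndex K b i A).card ≤ K * A.card := by
  unfold noiseIndex
  rw [Finset.card_product, Finset.card_univ, Fintype.card_fin]
  gcongr
  exact Finset.filter_subset _ _

lemma card_noiseIndex_le_activeCount (b : Fin M → ℤ) (i : Fin M) (A : Finset (Fin M)) :
    (noiseIndex K b i A).card ≤ K * activeCount b := by
  unfold noiseIndex activeCount
  rw [Finset.card_product, Finset.card_univ, Fintype.card_fin]
  refine Nat.mul_le_mul_left _ (Finset.card_le_card fun j hj => ?_)
  simp only [Finset.mem_filter, Finset.mem_univ, true_and] at hj ⊢
  exact hj.2.2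

/-- Union bound for the probability that all users decide `H1`. -/
lemma one_sub_le_passProb {p : unitInterval} (hp : 0 < p) (hK : 1 ≤ K) {b : Fin M → ℤ}
    (hb : ∀ j, b j = 1 ∨ b j = 0 ∨ b j = -1) {θ : ℝ} (hθ0 : 0 ≤ θ) (hθ : θ ≤ 1 / 2) :
    1 - M * Real.exp (-θ * (K * p * ∑ j, (b j : ℝ)) +
      K * activeCount b * (p * (1 - p) * θ ^ 2 / 2 + 2 * θ ^ 3)) ≤ passProb K p b := by
  have hp0 : (0 : ℝ) < p := hp
  have hp1 : (p : ℝ) ≤ 1 := p.2.2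
  set S := K * (p : ℝ) * ∑ j, (b j : ℝ)
  set B := Real.exp (-θ * S + K * activeCount b * (p * (1 - p) * θ ^ 2 / 2 + 2 * θ ^ 3))
  have hbad : ∀ i : Fin M, (graphLaw M K p).real {g | S ≤ linkNoise p b i Finset.univ g} ≤ B :=
    fun i => by
    refine ((bernoulliFamily_userLink p b i Finset.univ).tail_upper hp0.le hp1 _
      (noiseSign_eq hb) hθ0 hθ S).trans (Real.exp_le_exp.2 ?_)
    have h1 : ((noiseIndex K b i Finset.univ).card : ℝ) ≤ K * activeCount b := by
      exact_mod_cast card_noiseIndex_le_activeCount b i _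
    have h2 : 0 ≤ 1 - (p : ℝ) := by linarith
    gcongr
  have hsub : {g | ∀ i, CRN.finalDecision (p : ℝ) (fun j => (b j : ℝ)) g i = 1}ᶜ ⊆
      ⋃ i ∈ (Finset.univ : Finset (Fin M)),
        {g : Fin K → SimpleGraph (Fin M) | S ≤ linkNoise p b i Finset.univ g} := by
    intro g hg
    simp only [Set.mem_compl_iff, Set.mem_ofPred_eq, not_forall] at hg
    obtain ⟨i, hi⟩ := hg
    rw [finalDecision_eq_one_iff hp0 hK, not_le] at hi
    simp only [Set.mem_iUnion, Set.mem_ofPred_eq, Finset.mem_univ, exists_true_left]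
    exact ⟨i, hi.le⟩
  have h1 := (measureReal_mono (μ := graphLaw M K p) hsub (measure_ne_top _ _)).trans
    (measureReal_biUnion_finset_le _ _)
  have h2 : ∑ i : Fin M, (graphLaw M K p).real {g | S ≤ linkNoise p b i Finset.univ g} ≤ M * B := by
    refine (Finset.sum_le_card_nsmul _ _ B fun i _ => hbad i).trans ?_
    simp
  have h3 := measureReal_union_le (μ := graphLaw M K p)
    {g | ∀ i, CRN.finalDecision (p : ℝ) (fun j => (b j : ℝ)) g i = 1}
    {g | ∀ i, CRN.finalDecision (p : ℝ) (fun j => (b j : ℝ)) g i = 1}ᶜ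
  rw [Set.union_compl_self, probReal_univ] at h3
  unfold passProb
  linarith

lemma passProb_nonneg (p : unitInterval) (b : Fin M → ℤ) : 0 ≤ passProb K p b :=
  measureReal_nonneg

lemma passProb_le_one (p : unitInterval) (b : Fin M → ℤ) : passProb K p b ≤ 1 :=
  measureReal_le_one

/-- Independence, over the users in `I`, of the noise due to the users outside `I`. -/
lemma prob_forall_linkNoise_compl_le (p : unitInterval) (b : Fin M → ℤ) (I : Finset (Fin M))
    (t : ℝ) :
    (graphLaw M K p).real {g | ∀ i ∈ I, linkNoise p b i Iᶜ g ≤ t} =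
      ∏ i ∈ I, (graphLaw M K p).real {g | linkNoise p b i Iᶜ g ≤ t} := by
  classical
  have hfam := bernoulliFamily_links M K p ∅ (by simp)
  refine iIndepFun_blocks hfam.measurable hfam.indep I
    (fun i => (noiseIndex K b i Iᶜ).image fun k => (k.1, s(i, k.2))) ?_
    (fun i x => ∑ k ∈ noiseIndex K b i Iᶜ,
      (noiseSign K b k : ℝ) * ((x (k.1, s(i, k.2)) : ℝ) - p) ≤ t) ?_
  -- A link joining i ∈ I to a user outside I determines i, so distinct users of I use disjoint sets
  -- of links.
  · intro i hi j hj hij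
    rw [Finset.disjoint_left]
    intro k hk hk'
    obtain ⟨⟨u, l⟩, hl, rfl⟩ := Finset.mem_image.1 hk
    obtain ⟨⟨u', l'⟩, hl', h⟩ := Finset.mem_image.1 hk'
    simp only [noiseIndex, Finset.mem_product, Finset.mem_filter, Finset.mem_compl] at hl hl'
    simp only [Prod.mk.injEq, Sym2.eq_iff] at h
    rcases h.2 with h | h
    · exact hij h.1.symm
    · exact hl.2.1 (h.1 ▸ hj)
  · intro i x y hxy
    have : ∑ k ∈ noiseIndex K b i Iᶜ, (noiseSign K b k : ℝ) * ((x (k.1, s(i, k.2)) : ℝ) - p) =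
        ∑ k ∈ noiseIndex K b i Iᶜ, (noiseSign K b k : ℝ) * ((y (k.1, s(i, k.2)) : ℝ) - p) :=
      Finset.sum_congr rfl fun k hk => by rw [hxy _ (Finset.mem_image_of_mem _ hk)]
    rw [this]

/-- Upper bound for the probability that all users decide `H1`, by the independent parts of the
statistics of the users in `I`. -/
lemma passProb_le {p : unitInterval} (hp : 0 < p) (hK : 1 ≤ K) {b : Fin M → ℤ}
    (hb : ∀ j, b j = 1 ∨ b j = 0 ∨ b j = -1) (I : Finset (Fin M)) {d l σ : ℝ} (hd : 0 < d)
    (hl : 1 ≤ l)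
    (hσ : σ ^ 2 = p * (1 - p) * (K * (Iᶜ.filter fun j => b j ≠ 0).card))
    (hlσ : 2 * (l + 10) ≤ σ)
    (herr : 2 * (K * (Iᶜ.filter fun j => b j ≠ 0).card) * (l + 10) ^ 3 ≤ σ ^ 3 / 10)
    (hS : K * (p : ℝ) * ∑ j, (b j : ℝ) + d ≤ l * σ) :
    passProb K p b ≤ I.card * Real.exp (-d ^ 2 / (2 * (K * I.card))) +
      Real.exp (-(I.card * (Real.exp (-12) / (20 * l) * Real.exp (-l ^ 2 / 2)))) := by
  have hp0 : (0 : ℝ) < p := hp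
  have hp1 : (p : ℝ) ≤ 1 := p.2.2
  set q := Real.exp (-12) / (20 * l) * Real.exp (-l ^ 2 / 2)
  have hneg : ∀ (i : Fin M) (g : Fin K → SimpleGraph (Fin M)), -linkNoise p b i I g =
      BernoulliFamily.centeredSum (userLink i) p (fun k => -noiseSign K b k)
        (noiseIndex K b i I) g := fun i g => by
    simp [linkNoise, BernoulliFamily.centeredSum]
  have hin : ∀ i ∈ I, (graphLaw M K p).real {g | d ≤ -linkNoise p b i I g} ≤
      Real.exp (-d ^ 2 / (2 * (K * I.card))) := fun i _ => by
    simp only [hneg]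
    refine (bernoulliFamily_userLink p b i I).hoeffding_of_card_le _ (fun k => ?_) hd ?_
    · rcases noiseSign_eq hb k with h | h <;> simp [h]
    · exact_mod_cast card_noiseIndex_le b i I
  have hout : ∀ i ∈ I, (graphLaw M K p).real {g | linkNoise p b i Iᶜ g ≤ l * σ} ≤
      Real.exp (-q) := fun i hi => by
    have hcard : ((noiseIndex K b i Iᶜ).card : ℝ) =
        K * (Iᶜ.filter fun j => b j ≠ 0).card := by
      unfold noiseIndex
      rw [Finset.card_product, Finset.card_univ, Fintype.card_fin, Nat.cast_mul]
      congr 3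
      ext j
      simp only [Finset.mem_filter, Finset.mem_compl, and_congr_right_iff, and_iff_right_iff_imp]
      exact fun hj _ e => hj (e ▸ hi)
    have hfam := bernoulliFamily_userLink (K := K) p b i Iᶜ
    have h1 := hfam.tail_lower hp0.le hp1 _ (noiseSign_eq hb) hl (by rw [hcard]; exact hσ) hlσ
      (by rw [hcard]; exact herr)
    have hms : MeasurableSet {g : Fin K → SimpleGraph (Fin M) | l * σ < linkNoise p b i Iᶜ g} :=
      measurableSet_lt measurable_const (hfam.measurable_centeredSum _ _)
    have h2 : {g : Fin K → SimpleGraph (Fin M) | linkNoise p b i Iᶜ g ≤ l * σ} =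
        {g | l * σ < linkNoise p b i Iᶜ g}ᶜ := by ext g; simp
    rw [h2, probReal_compl_eq_one_sub hms]
    have h3 := Real.add_one_le_exp (-q)
    have h4 : q ≤ (graphLaw M K p).real {g | l * σ < linkNoise p b i Iᶜ g} := h1
    linarith
  -- If all users pass, then either some inner noise is at most -d, or every outer noise is at most
  -- K p S + d ≤ l σ.
  have hsub : {g | ∀ i, CRN.finalDecision (p : ℝ) (fun j => (b j : ℝ)) g i = 1} ⊆
      (⋃ i ∈ I, {g : Fin K → SimpleGraph (Fin M) | d ≤ -linkNoise p b i I g}) ∪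
        {g | ∀ i ∈ I, linkNoise p b i Iᶜ g ≤ l * σ} := by
    intro g hg
    by_contra hno
    simp only [Set.mem_union, Set.mem_iUnion, Set.mem_ofPred_eq, not_or, not_exists, not_le] at hno
    obtain ⟨h1, h2⟩ := hno
    refine h2 fun i hi => ?_
    have h3 := (finalDecision_eq_one_iff hp0 hK b g i).1 (hg i)
    rw [← linkNoise_add_compl p b i I g] at h3
    linarith [h1 i hi]
  refine (measureReal_mono hsub).trans ((measureReal_union_le _ _).trans (add_le_add ?_ ?_))
  · refine (measureReal_biUnion_finset_le _ _).trans ?_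
    refine (Finset.sum_le_card_nsmul _ _ _ hin).trans ?_
    simp
  · rw [prob_forall_linkNoise_compl_le]
    refine (Finset.prod_le_prod (fun _ _ => measureReal_nonneg) hout).trans ?_
    rw [Finset.prod_const, ← Real.exp_nat_mul, mul_neg]

end Noise

/-! ### The critical level `√(2 log M)` -/

/-- The level at which the maximum of `M` standard Gaussian variables concentrates. -/
noncomputable def critLevel (M : ℕ) : ℝ := √(2 * Real.log M)

lemma tendsto_critLevel : Filter.Tendsto critLevel Filter.atTop Filter.atTop :=
  Real.tendsto_sqrt_atTop.comp
    ((Real.tendsto_log_atTop.comp tendsto_natCast_atTop_atTop).const_mul_atTop (by norm_num))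

lemma exp_critLevel_sq {M : ℕ} (hM : 1 ≤ M) : Real.exp (critLevel M ^ 2 / 2) = M := by
  have h1 : (1 : ℝ) ≤ M := by exact_mod_cast hM
  unfold critLevel
  rw [Real.sq_sqrt (mul_nonneg (by norm_num) (Real.log_nonneg h1)), mul_div_cancel_left₀ _ two_ne_zero,
    Real.exp_log (by linarith)]

lemma eventually_critLevel {P : ℝ → Prop} (h : ∀ᶠ x in Filter.atTop, P x) :
    ∀ᶠ M : ℕ in Filter.atTop, P (critLevel M) :=
  tendsto_critLevel.eventually h

lemma eventually_pow_le_mul_exp (k : ℕ) (C : ℝ) {c a : ℝ} (hc : 0 < c) (ha : 0 < a) :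
    ∀ᶠ x : ℝ in Filter.atTop, (x + C) ^ k ≤ c * Real.exp (a * x) := by
  have h := ((isLittleO_pow_exp_pos_mul_atTop k ha).comp_tendsto
    (Filter.tendsto_atTop_add_const_right Filter.atTop C Filter.tendsto_id)).bound
    (mul_pos hc (Real.exp_pos (-(a * C))))
  filter_upwards [h] with x hx
  refine (le_abs_self _).trans (hx.trans (le_of_eq ?_))
  simp only [Function.comp, id, Real.norm_eq_abs, abs_of_pos (Real.exp_pos _)]
  rw [mul_assoc, ← Real.exp_add]
  ring_nf

/-- √M is exp(L²/4), which is at least exp L once L ≥ 4, and this beats any power of L. -/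
lemma eventually_critLevel_pow_le (k : ℕ) (C : ℝ) {c : ℝ} (hc : 0 < c) :
    ∀ᶠ M : ℕ in Filter.atTop, (critLevel M + C) ^ k ≤ c * √M := by
  filter_upwards [eventually_critLevel (eventually_pow_le_mul_exp k C hc one_pos),
    eventually_critLevel (Filter.eventually_ge_atTop 4), Filter.eventually_ge_atTop 1]
    with M h1 h2 h3
  refine h1.trans (mul_le_mul_of_nonneg_left ?_ hc.le)
  rw [← exp_critLevel_sq h3, Real.sqrt_eq_rpow, ← Real.exp_mul, Real.exp_le_exp]
  nlinarith

/-! ### Asymptotics of the probability of a unanimous decision -/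

section

variable {p : unitInterval} {K : ℕ}

/-- Converts the scale of the decision sum in the Gaussian formula into the standard deviation of
the link noise. -/
lemma mul_sqrt_scale {p' K' : ℝ} (hp0 : 0 < p') (hK : 0 < K') (N : ℝ) :
    K' * p' * √((1 - p') * N / (p' * K')) = √(p' * (1 - p') * (K' * N)) := by
  nth_rewrite 1 [← Real.sqrt_sq (show 0 ≤ K' * p' by positivity)]
  rw [← Real.sqrt_mul (by positivity)]
  congr 1
  field_simp

/-- Chernoff's bound at the Gaussian optimum θ = (L + w)/σ has exponent at most -(L + w)²/2 + 1, the
1 bounding the cubic error. The union bound costs M = exp(L²/2), which leaves at most exp(-wL + 1).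
-/
lemma eventually_one_sub_le_passProb (hp0 : 0 < p) (hp1 : p < 1) (hK : 1 ≤ K) {δ w ε : ℝ}
    (hδ : 0 < δ) (hw : 0 < w) (hε : 0 < ε) :
    ∀ᶠ M : ℕ in Filter.atTop, ∀ b : Fin M → ℤ, (∀ j, b j = 1 ∨ b j = 0 ∨ b j = -1) →
      δ * M ≤ activeCount b →
      √((1 - (p : ℝ)) * activeCount b / (p * K)) * (critLevel M + w) ≤ ∑ j, (b j : ℝ) →
      1 - ε ≤ passProb K p b := by
  have hp0' : (0 : ℝ) < p := hp0
  have hp1' : (p : ℝ) < 1 := hp1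
  have hK' : (1 : ℝ) ≤ K := by exact_mod_cast hK
  set v : ℝ := p * (1 - p) with hv
  have hv0 : 0 < v := mul_pos hp0' (by linarith)
  have hc : 0 < √(v * δ) := Real.sqrt_pos.2 (by positivity)
  have hexp : ∀ᶠ x : ℝ in Filter.atTop, Real.exp (-(w * x) + 1) ≤ ε := by
    have h : Filter.Tendsto (fun x : ℝ => -(w * x) + 1) Filter.atTop Filter.atBot :=
      Filter.tendsto_atBot_add_const_right _ _
        (Filter.tendsto_neg_atTop_atBot.comp (Filter.tendsto_id.const_mul_atTop hw))
    filter_upwards [h.eventually (Filter.eventually_le_atBot (Real.log ε))] with x hx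
    exact (Real.exp_le_exp.2 hx).trans (Real.exp_log hε).le
  filter_upwards [eventually_critLevel_pow_le 3 w (c := v * √(v * δ) / 2) (by positivity),
    eventually_critLevel_pow_le 1 w (c := √(v * δ) / 2) (by positivity),
    eventually_critLevel hexp, eventually_critLevel (Filter.eventually_ge_atTop 1),
    Filter.eventually_ge_atTop 1] with M h1 h2 h3 h4 hM b hb hN hS
  set L := critLevel M
  set N : ℝ := ((activeCount b : ℕ) : ℝ) with hNdef
  have hM' : (1 : ℝ) ≤ M := by exact_mod_cast hM
  have hN0 : 0 < N := lt_of_lt_of_le (by positivity) hN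
  set σ := √(v * (K * N)) with hσdef
  have hσsq : σ ^ 2 = v * (K * N) := Real.sq_sqrt (by positivity)
  have hσlow : √(v * δ) * √M ≤ σ := by
    rw [← Real.sqrt_mul (by positivity), hσdef]
    apply Real.sqrt_le_sqrt
    rw [mul_assoc]
    refine mul_le_mul_of_nonneg_left (hN.trans ?_) hv0.le
    exact le_mul_of_one_le_left hN0.le hK'
  have hσ0 : 0 < σ := lt_of_lt_of_le (by positivity) hσlow
  set θ := (L + w) / σ with hθ
  have hLw : 0 < L + w := by linarith
  have hθ0 : 0 ≤ θ := by positivity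
  have hθσ : θ * σ = L + w := div_mul_cancel₀ _ hσ0.ne'
  have hθ2 : θ ≤ 1 / 2 := by
    rw [hθ, div_le_iff₀ hσ0]
    rw [pow_one] at h2
    linarith
  refine le_trans ?_ (one_sub_le_passProb hp0 hK hb hθ0 hθ2)
  have hS2 : σ * (L + w) ≤ K * p * ∑ j, (b j : ℝ) := by
    rw [hσdef, hv, ← mul_sqrt_scale hp0' (by linarith), mul_assoc]
    exact mul_le_mul_of_nonneg_left hS (by positivity)
  have hmain : -θ * (K * p * ∑ j, (b j : ℝ)) +
      K * N * (p * (1 - p) * θ ^ 2 / 2 + 2 * θ ^ 3) ≤ -(L + w) ^ 2 / 2 + 1 := by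
    have e1 : θ * (σ * (L + w)) ≤ θ * (K * p * ∑ j, (b j : ℝ)) :=
      mul_le_mul_of_nonneg_left hS2 hθ0
    have e2 : θ * (σ * (L + w)) = (L + w) ^ 2 := by rw [← mul_assoc, hθσ]; ring
    have e3 : K * N * (v * θ ^ 2 / 2) = (L + w) ^ 2 / 2 := by
      calc _ = v * (K * N) * θ ^ 2 / 2 := by ring
        _ = (θ * σ) ^ 2 / 2 := by rw [← hσsq]; ring
        _ = _ := by rw [hθσ]
    have e4 : K * N * (2 * θ ^ 3) ≤ 1 := by
      have : v * σ * (K * N * (2 * θ ^ 3)) = 2 * (L + w) ^ 3 := by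
        calc _ = 2 * (v * (K * N)) * σ * θ ^ 3 := by ring
          _ = 2 * (θ * σ) ^ 3 := by rw [← hσsq]; ring
          _ = _ := by rw [hθσ]
      have h5 : 2 * (L + w) ^ 3 ≤ v * σ := by
        have := mul_le_mul_of_nonneg_left hσlow hv0.le
        linarith
      rw [← this] at h5
      exact le_of_mul_le_mul_left (by linarith) (mul_pos hv0 hσ0)
    rw [← hv, mul_add, e3]
    linarith
  have h6 : M * Real.exp (-θ * (K * p * ∑ j, (b j : ℝ)) +
      K * N * (p * (1 - p) * θ ^ 2 / 2 + 2 * θ ^ 3)) ≤ ε := by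
    refine le_trans ?_ h3
    rw [← exp_critLevel_sq hM, ← Real.exp_add, Real.exp_le_exp]
    change L ^ 2 / 2 + _ ≤ _
    have := sq_nonneg w
    linarith
  linarith

lemma le_of_pow_mul_le {L A M x y z : ℝ} (hL : 0 < L) (hy : 0 < y)
    (h : L ^ 5 * (20 * A * y) ≤ M * (x * y) * z) : A ≤ M / L ^ 4 * (z / (20 * L) * x) := by
  have e : M / L ^ 4 * (z / (20 * L) * x) = M * (x * y) * z / (20 * L ^ 5 * y) := by
    field_simp
  rw [e, le_div_iff₀ (by positivity)]
  linarith

-- About M/L⁴ users are kept. This is few enough that the noise among them exceeds σw/4 with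
-- probability at most exp(-c₁L⁴), which beats the number of users, and that the variance lost is
-- negligible even after multiplication by L. It is many enough that the expected number of outer
-- noises beyond the level L - w/2 is at least of order exp(wL/2)/L⁵, which diverges.
set_option maxHeartbeats 1000000 in
lemma eventually_passProb_le (hp0 : 0 < p) (hp1 : p < 1) (hK : 1 ≤ K) {δ w ε : ℝ}
    (hδ : 0 < δ) (hw : 0 < w) (hε : 0 < ε) :
    ∀ᶠ M : ℕ in Filter.atTop, ∀ b : Fin M → ℤ, (∀ j, b j = 1 ∨ b j = 0 ∨ b j = -1) →
      δ * M ≤ activeCount b →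
      ∑ j, (b j : ℝ) ≤ √((1 - (p : ℝ)) * activeCount b / (p * K)) * (critLevel M - w) →
      passProb K p b ≤ ε := by
  have hp0' : (0 : ℝ) < p := hp0
  have hp1' : (p : ℝ) < 1 := hp1
  have hK' : (1 : ℝ) ≤ K := by exact_mod_cast hK
  set v : ℝ := p * (1 - p) with hv
  have hv0 : 0 < v := mul_pos hp0' (by linarith)
  have hc : 0 < √(v * (δ / 2)) := Real.sqrt_pos.2 (by positivity)
  set c₁ : ℝ := v * w ^ 2 * δ / 64 with hc₁
  have hc₁0 : 0 < c₁ := by positivity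
  set A : ℝ := |Real.log (ε / 2)| + 1 with hA
  have hA0 : 0 < A := by positivity
  have hexp2 : Real.exp (-A) ≤ ε / 2 := by
    refine (Real.exp_le_exp.2 ?_).trans (Real.exp_log (half_pos hε)).le
    linarith [neg_abs_le (Real.log (ε / 2))]
  filter_upwards [eventually_critLevel_pow_le 3 10 (c := v * √(v * (δ / 2)) / 20) (by positivity),
    eventually_critLevel_pow_le 1 10 (c := √(v * (δ / 2)) / 2) (by positivity),
    eventually_critLevel_pow_le 4 0 (c := 1) one_pos,
    eventually_critLevel (eventually_pow_le_mul_exp 5 0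
      (c := Real.exp (-12) / (20 * A * Real.exp (w ^ 2 / 8))) (by positivity)
      (half_pos hw)),
    eventually_critLevel (Filter.eventually_ge_atTop (1 + w)),
    eventually_critLevel (Filter.eventually_ge_atTop (8 / (δ * w))),
    eventually_critLevel (Filter.eventually_ge_atTop (4 / δ)),
    eventually_critLevel (Filter.eventually_ge_atTop (1 / c₁)),
    eventually_critLevel (Filter.eventually_ge_atTop (2 * A)),
    Filter.eventually_ge_atTop 1] with M h1 h2 h3 h4 h5 h6 h7 h8 h9 hM b hb hN hS
  set L := critLevel M
  set N : ℝ := ((activeCount b : ℕ) : ℝ) with hNdef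
  have hL1 : 1 ≤ L := by linarith
  have hL0 : 0 < L := by linarith
  have hM' : (1 : ℝ) ≤ M := by exact_mod_cast hM
  have hN0 : 0 < N := lt_of_lt_of_le (by positivity) hN
  -- the subset of users
  have hsqrtM : √(M : ℝ) ≤ M := by
    rw [Real.sqrt_le_left (by linarith)]
    exact le_self_pow₀ hM' (by norm_num)
  have hL4 : L ^ 4 ≤ M := by
    rw [add_zero, one_mul] at h3; linarith
  have hL41 : 1 ≤ L ^ 4 := one_le_pow₀ hL1
  set m := ⌈(M : ℝ) / L ^ 4⌉₊ with hm
  have hm1 : (M : ℝ) / L ^ 4 ≤ m := Nat.le_ceil _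
  have hdiv1 : 1 ≤ (M : ℝ) / L ^ 4 := by rw [one_le_div (by positivity)]; exact hL4
  have hm2 : (m : ℝ) ≤ 2 * (M / L ^ 4) := by
    have := Nat.ceil_lt_add_one (show 0 ≤ (M : ℝ) / L ^ 4 by positivity)
    linarith
  have hmM : m ≤ M := by
    rw [hm, Nat.ceil_le]
    exact div_le_self (by linarith) hL41
  have hm0 : (0 : ℝ) < m := by linarith
  obtain ⟨I, -, hI⟩ := Finset.exists_subset_card_eq
    (s := (Finset.univ : Finset (Fin M))) (n := m) (by simpa using hmM)
  set N' : ℝ := ((Iᶜ.filter fun j => b j ≠ 0).card : ℝ) with hN'def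
  have hN'le : N' ≤ N := by
    rw [hN'def, hNdef]
    unfold activeCount
    exact_mod_cast Finset.card_le_card (Finset.filter_subset_filter _ (Finset.subset_univ _))
  have hN'ge : N - m ≤ N' := by
    have : activeCount b ≤ (Iᶜ.filter fun j => b j ≠ 0).card + m := by
      unfold activeCount
      rw [← hI]
      refine (Finset.card_le_card fun j hj => ?_).trans (Finset.card_union_le _ _)
      simp only [Finset.mem_filter, Finset.mem_univ, true_and, Finset.mem_union,
        Finset.mem_compl] at hj ⊢
      tauto
    have h' : N ≤ N' + m := by rw [hN'def, hNdef]; exact_mod_cast this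
    linarith
  -- the fraction of users that is left out
  set κ := 2 / (δ * L ^ 4) with hκ
  have hκm : (m : ℝ) ≤ κ * N := by
    have : κ * (δ * M) = 2 * (M / L ^ 4) := by rw [hκ]; field_simp
    have h' := mul_le_mul_of_nonneg_left hN (show 0 ≤ κ by positivity)
    linarith
  have hLpow : L ≤ L ^ 3 := le_self_pow₀ hL1 (by norm_num)
  have hLpow4 : L ≤ L ^ 4 := le_self_pow₀ hL1 (by norm_num)
  have hκL : κ * L ≤ w / 4 := by
    rw [hκ, div_mul_eq_mul_div, div_le_iff₀ (by positivity)]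
    rw [div_le_iff₀ (by positivity)] at h6
    have e1 : 8 * L ≤ L * (δ * w) * L := mul_le_mul_of_nonneg_right h6 hL0.le
    have e2 : L * (δ * w) * L ≤ L ^ 3 * (δ * w) * L := by gcongr
    linarith
  have hκ2 : κ ≤ 1 / 2 := by
    rw [hκ, div_le_iff₀ (by positivity)]
    rw [div_le_iff₀ hδ] at h7
    have : L * δ ≤ L ^ 4 * δ := by gcongr
    linarith
  have hN'half : δ / 2 * M ≤ N' := by
    have := mul_le_mul_of_nonneg_right hκ2 hN0.le
    linarith
  have hN'0 : 0 < N' := lt_of_lt_of_le (by positivity) hN'half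
  set σ := √(v * (K * N)) with hσdef
  set σ' := √(v * (K * N')) with hσ'def
  have hσsq : σ ^ 2 = v * (K * N) := Real.sq_sqrt (by positivity)
  have hσ'sq : σ' ^ 2 = v * (K * N') := Real.sq_sqrt (by positivity)
  have hσ0 : 0 < σ := Real.sqrt_pos.2 (by positivity)
  have hσ'0 : 0 < σ' := Real.sqrt_pos.2 (by positivity)
  have hσ'low : √(v * (δ / 2)) * √M ≤ σ' := by
    rw [← Real.sqrt_mul (by positivity), hσ'def]
    apply Real.sqrt_le_sqrt
    rw [mul_assoc]
    refine mul_le_mul_of_nonneg_left (hN'half.trans ?_) hv0.le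
    exact le_mul_of_one_le_left hN'0.le hK'
  have hσσ' : (1 - κ) * σ ≤ σ' := by
    have hk0 : 0 ≤ κ := by positivity
    refine le_of_sq_le_sq ?_ hσ'0.le
    rw [mul_pow, hσsq, hσ'sq]
    have h' : (1 - κ) ^ 2 * N ≤ N' := by
      have e1 : (1 - κ) ^ 2 ≤ 1 - κ := by
        rw [sq]; exact mul_le_of_le_one_left (by linarith) (by linarith)
      have e2 := mul_le_mul_of_nonneg_right e1 hN0.le
      linarith
    have := mul_le_mul_of_nonneg_left h' (show 0 ≤ v * K by positivity)
    linarith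
  -- The gap w is shared out: w/4 for the inner noise d, w/4 for the variance loss κL, and w/2 to
  -- make the expected number of exceedances large.
  set l := L - w / 2 with hl
  have hl1 : 1 ≤ l := by linarith
  set d := σ * (w / 4) with hd
  have hd0 : 0 < d := by positivity
  have hSd : K * (p : ℝ) * ∑ j, (b j : ℝ) + d ≤ l * σ' := by
    have e1 : K * (p : ℝ) * ∑ j, (b j : ℝ) ≤ σ * (L - w) := by
      rw [hσdef, hv, ← mul_sqrt_scale hp0' (by linarith),
        mul_assoc (K * (p : ℝ)) (√_)]
      exact mul_le_mul_of_nonneg_left hS (by positivity)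
    have e2 : l * ((1 - κ) * σ) ≤ l * σ' := mul_le_mul_of_nonneg_left hσσ' (by linarith)
    have e3 : σ * (κ * L) ≤ σ * (w / 4) := mul_le_mul_of_nonneg_left hκL hσ0.le
    have e4 : 0 ≤ σ * (κ * w) := by positivity
    rw [hd]
    rw [hl] at e2 ⊢
    linarith
  have hl10 : l + 10 ≤ L + 10 := by linarith
  have hpass := passProb_le (K := K) hp0 hK hb I hd0 hl1 hσ'sq
    (by rw [pow_one] at h2; linarith)
    (by
      have e1 : (l + 10) ^ 3 ≤ (L + 10) ^ 3 := by gcongr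
      have e2 : 20 * (L + 10) ^ 3 ≤ v * σ' := by
        have := mul_le_mul_of_nonneg_left hσ'low hv0.le
        linarith
      have e3 : v * (2 * (K * N') * (l + 10) ^ 3) ≤ v * (σ' ^ 3 / 10) := by
        have e4 : v * (2 * (K * N') * (l + 10) ^ 3) = 2 * σ' ^ 2 * (l + 10) ^ 3 := by
          rw [hσ'sq]; ring
        have e5 : σ' ^ 2 * (20 * (l + 10) ^ 3) ≤ σ' ^ 2 * (v * σ') :=
          mul_le_mul_of_nonneg_left (by linarith) (by positivity)
        rw [e4]
        linarith
      exact le_of_mul_le_mul_left e3 hv0)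
    hSd
  rw [hI] at hpass
  have hfirst : m * Real.exp (-d ^ 2 / (2 * (K * m))) ≤ ε / 2 := by
    have e1 : c₁ * L ^ 4 ≤ d ^ 2 / (2 * (K * m)) := by
      rw [le_div_iff₀ (by positivity), hd, mul_pow, hσsq, hc₁]
      have e2 : (m : ℝ) * L ^ 4 ≤ 2 * M := by
        have := mul_le_mul_of_nonneg_right hm2 (show 0 ≤ L ^ 4 by positivity)
        rwa [mul_assoc, div_mul_cancel₀ _ (by positivity)] at this
      have e3 : v * w ^ 2 * K * (δ * (m * L ^ 4)) ≤ v * w ^ 2 * K * (2 * N) := by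
        refine mul_le_mul_of_nonneg_left ?_ (by positivity)
        have := mul_le_mul_of_nonneg_left e2 hδ.le
        linarith
      linarith
    have e4 : L ^ 2 ≤ c₁ * L ^ 4 := by
      rw [div_le_iff₀ hc₁0] at h8
      have hL2 : L ≤ L ^ 2 := le_self_pow₀ hL1 (by norm_num)
      have h' : 1 ≤ c₁ * L ^ 2 := by
        have := mul_le_mul_of_nonneg_left hL2 hc₁0.le
        linarith
      have := mul_le_mul_of_nonneg_right h' (sq_nonneg L)
      linarith
    have e5 : (m : ℝ) ≤ Real.exp (L ^ 2 / 2) := by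
      rw [exp_critLevel_sq hM]; exact_mod_cast hmM
    calc m * Real.exp (-d ^ 2 / (2 * (K * m)))
        ≤ Real.exp (L ^ 2 / 2) * Real.exp (-d ^ 2 / (2 * (K * m))) := by gcongr
      _ ≤ Real.exp (-A) := by
          rw [← Real.exp_add, Real.exp_le_exp, neg_div]
          have hL2 : L ≤ L ^ 2 := le_self_pow₀ hL1 (by norm_num)
          linarith
      _ ≤ ε / 2 := hexp2
  have hsecond : Real.exp (-(m * (Real.exp (-12) / (20 * l) * Real.exp (-l ^ 2 / 2)))) ≤
      ε / 2 := by
    refine (Real.exp_le_exp.2 (neg_le_neg ?_)).trans hexp2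
    rw [add_zero, mul_comm (_ / _), ← mul_div_assoc, le_div_iff₀ (by positivity)] at h4
    have e1 : Real.exp (L ^ 2 / 2) * Real.exp (-l ^ 2 / 2) * Real.exp (w ^ 2 / 8) =
        Real.exp (w / 2 * L) := by
      rw [← Real.exp_add, ← Real.exp_add, hl]; ring_nf
    have e2 : M * (Real.exp (-l ^ 2 / 2) * Real.exp (w ^ 2 / 8)) = Real.exp (w / 2 * L) := by
      rw [← e1, exp_critLevel_sq hM]; ring
    have e3 : M / L ^ 4 * (Real.exp (-12) / (20 * L) * Real.exp (-l ^ 2 / 2)) ≤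
        m * (Real.exp (-12) / (20 * l) * Real.exp (-l ^ 2 / 2)) := by
      refine mul_le_mul hm1 ?_ (by positivity) (by positivity)
      refine mul_le_mul_of_nonneg_right ?_ (Real.exp_pos _).le
      exact div_le_div_of_nonneg_left (Real.exp_pos _).le (by linarith) (by linarith)
    refine le_trans ?_ e3
    rw [← e2] at h4
    exact le_of_pow_mul_le hL0 (Real.exp_pos _) h4
  linarith

end

/-! ### The Gaussian approximation -/

lemma integrable_exp_neg_sq_half : Integrable fun t : ℝ => Real.exp (-t ^ 2 / 2) := by
  have := integrable_exp_neg_mul_sq (b := 1 / 2) (by norm_num)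
  convert this using 3
  ring

lemma integral_exp_neg_sq_half : ∫ t : ℝ, Real.exp (-t ^ 2 / 2) = √(2 * Real.pi) := by
  have := integral_gaussian (1 / 2)
  convert this using 4 <;> ring

lemma gaussQ_nonneg (z : ℝ) : 0 ≤ CRN.gaussQ z :=
  mul_nonneg (by positivity) (integral_nonneg fun _ => (Real.exp_pos _).le)

lemma gaussQ_le_one (z : ℝ) : CRN.gaussQ z ≤ 1 := by
  unfold CRN.gaussQ
  have h : ∫ t in Set.Ioi z, Real.exp (-t ^ 2 / 2) ≤ √(2 * Real.pi) := by
    rw [← integral_exp_neg_sq_half]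
    exact setIntegral_le_integral integrable_exp_neg_sq_half
      (Filter.Eventually.of_forall fun _ => (Real.exp_pos _).le)
  have hpos : 0 < √(2 * Real.pi) := Real.sqrt_pos.2 (by positivity)
  rw [one_div_mul_eq_div, div_le_one hpos]
  exact h

lemma gaussQ_antitone : Antitone CRN.gaussQ := by
  intro x y hxy
  unfold CRN.gaussQ
  refine mul_le_mul_of_nonneg_left ?_ (by positivity)
  exact setIntegral_mono_set integrable_exp_neg_sq_half.integrableOn
    (Filter.Eventually.of_forall fun _ => (Real.exp_pos _).le)
    (Set.Ioi_subset_Ioi hxy).eventuallyLE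

/-- For t ≥ z ≥ 0 one has t² ≥ z² + (t - z)², and the remaining integral is bounded by the full
Gaussian one. -/
lemma gaussQ_le_exp {z : ℝ} (hz : 0 ≤ z) : CRN.gaussQ z ≤ Real.exp (-z ^ 2 / 2) := by
  unfold CRN.gaussQ
  have hint : Integrable fun t : ℝ => Real.exp (-z ^ 2 / 2) * Real.exp (-(t - z) ^ 2 / 2) :=
    (integrable_exp_neg_sq_half.comp_sub_right z).const_mul _
  have h : ∫ t in Set.Ioi z, Real.exp (-t ^ 2 / 2) ≤
      Real.exp (-z ^ 2 / 2) * √(2 * Real.pi) := by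
    calc ∫ t in Set.Ioi z, Real.exp (-t ^ 2 / 2)
        ≤ ∫ t in Set.Ioi z, Real.exp (-z ^ 2 / 2) * Real.exp (-(t - z) ^ 2 / 2) := by
          refine setIntegral_mono_on integrable_exp_neg_sq_half.integrableOn hint.integrableOn
            measurableSet_Ioi fun t ht => ?_
          rw [← Real.exp_add, Real.exp_le_exp]
          have := mul_nonneg hz (sub_nonneg.2 (Set.mem_Ioi.1 ht).le)
          nlinarith
      _ ≤ ∫ t, Real.exp (-z ^ 2 / 2) * Real.exp (-(t - z) ^ 2 / 2) :=
          setIntegral_le_integral hint (Filter.Eventually.of_forall fun _ => by positivity)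
      _ = Real.exp (-z ^ 2 / 2) * √(2 * Real.pi) := by
          rw [integral_const_mul, integral_sub_right_eq_self (fun t => Real.exp (-t ^ 2 / 2)) z,
            integral_exp_neg_sq_half]
  have hpos : 0 < √(2 * Real.pi) := Real.sqrt_pos.2 (by positivity)
  rw [one_div_mul_eq_div, div_le_iff₀ hpos]
  exact h

/-- Only the interval (z, z + u] is kept, where the integrand is smallest at the right end. -/
lemma le_gaussQ {z u : ℝ} (hz : 0 ≤ z) (hu : 0 ≤ u) :
    u / √(2 * Real.pi) * Real.exp (-(z + u) ^ 2 / 2) ≤ CRN.gaussQ z := by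
  unfold CRN.gaussQ
  have h : u * Real.exp (-(z + u) ^ 2 / 2) ≤ ∫ t in Set.Ioi z, Real.exp (-t ^ 2 / 2) := by
    calc u * Real.exp (-(z + u) ^ 2 / 2)
        = ∫ _t in Set.Ioc z (z + u), Real.exp (-(z + u) ^ 2 / 2) := by
          rw [setIntegral_const]
          simp [hu]
      _ ≤ ∫ t in Set.Ioc z (z + u), Real.exp (-t ^ 2 / 2) := by
          refine setIntegral_mono_on (integrableOn_const (by simp))
            integrable_exp_neg_sq_half.integrableOn measurableSet_Ioc fun t ht => ?_
          rw [Real.exp_le_exp]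
          have h1 : 0 ≤ t := hz.trans ht.1.le
          have : t ^ 2 ≤ (z + u) ^ 2 := pow_le_pow_left₀ h1 ht.2 2
          linarith
      _ ≤ ∫ t in Set.Ioi z, Real.exp (-t ^ 2 / 2) :=
          setIntegral_mono_set integrable_exp_neg_sq_half.integrableOn
            (Filter.Eventually.of_forall fun _ => (Real.exp_pos _).le)
            Set.Ioc_subset_Ioi_self.eventuallyLE
  rw [one_div_mul_eq_div, div_mul_eq_mul_div]
  gcongr

/-- The product of Gaussian factors for `c` censoring users and sum `S` of the decisions. -/
noncomputable def gaussFactor (M K : ℕ) (p : ℝ) (c : ℕ) (S : ℝ) : ℝ :=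
  (1 - CRN.gaussQ (S / √((1 - p) * ((M : ℝ) - c) / (p * K)))) ^ c *
    (1 - CRN.gaussQ (S / √((1 - p) * ((M : ℝ) - 1 - c) / (p * K)))) ^ (M - c)

lemma gaussFactor_nonneg (M K : ℕ) (p : ℝ) (c : ℕ) (S : ℝ) : 0 ≤ gaussFactor M K p c S :=
  mul_nonneg (pow_nonneg (sub_nonneg.2 (gaussQ_le_one _)) _)
    (pow_nonneg (sub_nonneg.2 (gaussQ_le_one _)) _)

lemma gaussFactor_le_one (M K : ℕ) (p : ℝ) (c : ℕ) (S : ℝ) : gaussFactor M K p c S ≤ 1 :=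
  mul_le_one₀ (pow_le_one₀ (sub_nonneg.2 (gaussQ_le_one _)) (by linarith [gaussQ_nonneg (S / √((1 - p) * ((M : ℝ) - c) / (p * K)))]))
    (pow_nonneg (sub_nonneg.2 (gaussQ_le_one _)) _)
    (pow_le_one₀ (sub_nonneg.2 (gaussQ_le_one _)) (by linarith [gaussQ_nonneg (S / √((1 - p) * ((M : ℝ) - 1 - c) / (p * K)))]))

/-- All M factors are at least 1 - exp(-(L + w)²/2), the smaller denominator with N - 1 only
helping; Bernoulli's inequality then loses at most M exp(-(L + w)²/2) ≤ exp(-wL). -/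
lemma eventually_one_sub_le_gaussFactor {p : ℝ} (hp0 : 0 < p) (hp1 : p < 1) {K : ℕ} (hK : 1 ≤ K)
    {δ w ε : ℝ} (hδ : 0 < δ) (hw : 0 < w) (hε : 0 < ε) :
    ∀ᶠ M : ℕ in Filter.atTop, ∀ c ≤ M, ∀ S : ℝ, δ * M ≤ ((M - c : ℕ) : ℝ) →
      √((1 - p) * ((M - c : ℕ) : ℝ) / (p * K)) * (critLevel M + w) ≤ S →
      1 - ε ≤ gaussFactor M K p c S := by
  have hK' : (0 : ℝ) < K := by exact_mod_cast hK
  have hexp : ∀ᶠ x : ℝ in Filter.atTop, Real.exp (-(w * x)) ≤ ε := by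
    have h : Filter.Tendsto (fun x : ℝ => -(w * x)) Filter.atTop Filter.atBot :=
      Filter.tendsto_neg_atTop_atBot.comp (Filter.tendsto_id.const_mul_atTop hw)
    filter_upwards [h.eventually (Filter.eventually_le_atBot (Real.log ε))] with x hx
    exact (Real.exp_le_exp.2 hx).trans (Real.exp_log hε).le
  filter_upwards [eventually_critLevel hexp, eventually_critLevel (Filter.eventually_ge_atTop 1),
    Filter.eventually_ge_atTop 1,
    tendsto_natCast_atTop_atTop.eventually (Filter.eventually_ge_atTop (2 / δ))]
    with M h1 h2 hM h3 c hc S hN hS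
  rw [Nat.cast_sub hc] at hN hS
  set L := critLevel M
  set N : ℝ := (M : ℝ) - c with hNdef
  have hN2 : 2 ≤ N := by
    rw [div_le_iff₀ hδ] at h3
    linarith
  have hp1' : 0 < 1 - p := by linarith
  set x := Real.exp (-(L + w) ^ 2 / 2) with hx
  have hS0 : 0 ≤ S := le_trans (by positivity) hS
  have hQ : ∀ N', 0 < N' → N' ≤ N → CRN.gaussQ (S / √((1 - p) * N' / (p * K))) ≤ x := by
    intro N' hN'0 hN'
    have h5 : L + w ≤ S / √((1 - p) * N' / (p * K)) := by
      rw [le_div_iff₀ (Real.sqrt_pos.2 (by positivity)), mul_comm]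
      refine le_trans ?_ hS
      gcongr
    exact (gaussQ_antitone h5).trans (gaussQ_le_exp (by positivity))
  have hx1 : x ≤ 1 := by
    rw [hx, ← Real.exp_zero, Real.exp_le_exp]
    have := sq_nonneg (L + w)
    linarith
  have hf1 := hQ N (by linarith) le_rfl
  have hf2 := hQ ((M : ℝ) - 1 - c) (by linarith) (by linarith)
  unfold gaussFactor
  calc 1 - ε ≤ 1 - M * x := by
        have : M * x ≤ ε := by
          refine le_trans ?_ h1
          rw [hx, ← exp_critLevel_sq hM, ← Real.exp_add, Real.exp_le_exp]
          change L ^ 2 / 2 + _ ≤ -(w * L)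
          have := sq_nonneg w
          linarith
        linarith
    _ ≤ (1 - x) ^ M := by
        have := one_add_mul_le_pow (a := -x) (by linarith) M
        rw [← sub_eq_add_neg] at this
        linarith
    _ = (1 - x) ^ c * (1 - x) ^ (M - c) := by rw [← pow_add, Nat.add_sub_cancel' hc]
    _ ≤ _ := by
        refine mul_le_mul (pow_le_pow_left₀ (by linarith) (by linarith) _)
          (pow_le_pow_left₀ (by linarith) (by linarith) _)
          (pow_nonneg (by linarith) _) (pow_nonneg (by linarith) _)

/-- All M factors are at most 1 - q ≤ exp(-q) with q the Gaussian tail at L - w/2, and M q diverges.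
Half of the gap w absorbs the passage from N to N - 1 in the denominator. -/
lemma eventually_gaussFactor_le {p : ℝ} (hp0 : 0 < p) (hp1 : p < 1) {K : ℕ} (hK : 1 ≤ K)
    {δ w ε : ℝ} (hδ : 0 < δ) (hw : 0 < w) (hε : 0 < ε) :
    ∀ᶠ M : ℕ in Filter.atTop, ∀ c ≤ M, ∀ S : ℝ, δ * M ≤ ((M - c : ℕ) : ℝ) →
      S ≤ √((1 - p) * ((M - c : ℕ) : ℝ) / (p * K)) * (critLevel M - w) →
      gaussFactor M K p c S ≤ ε := by
  have hK' : (0 : ℝ) < K := by exact_mod_cast hK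
  set A : ℝ := |Real.log ε| with hA
  have hexp2 : Real.exp (-A) ≤ ε := by
    refine (Real.exp_le_exp.2 ?_).trans (Real.exp_log hε).le
    linarith [neg_abs_le (Real.log ε)]
  have hpi : 0 < √(2 * Real.pi) := Real.sqrt_pos.2 (by positivity)
  have hexp : ∀ᶠ x : ℝ in Filter.atTop,
      A ≤ w / 4 / √(2 * Real.pi) * Real.exp (w / 4 * x + -(w ^ 2 / 32)) := by
    have h : Filter.Tendsto (fun x : ℝ => w / 4 / √(2 * Real.pi) *
        Real.exp (w / 4 * x + -(w ^ 2 / 32))) Filter.atTop Filter.atTop :=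
      (Real.tendsto_exp_atTop.comp (Filter.tendsto_atTop_add_const_right _ _
        (Filter.tendsto_id.const_mul_atTop (by positivity)))).const_mul_atTop (by positivity)
    exact h.eventually (Filter.eventually_ge_atTop A)
  filter_upwards [eventually_critLevel hexp,
    eventually_critLevel (Filter.eventually_ge_atTop (1 + w)),
    eventually_critLevel_pow_le 1 0 (c := w * δ / 2) (by positivity),
    Filter.eventually_ge_atTop 1,
    tendsto_natCast_atTop_atTop.eventually (Filter.eventually_ge_atTop (2 / δ))]
    with M h1 h2 h4 hM h3 c hc S hN hS
  rw [Nat.cast_sub hc] at hN hS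
  set L := critLevel M
  set N : ℝ := (M : ℝ) - c with hNdef
  have hM' : (1 : ℝ) ≤ M := by exact_mod_cast hM
  have hN2 : 2 ≤ N := by
    rw [div_le_iff₀ hδ] at h3
    linarith
  have hp1' : 0 < 1 - p := by linarith
  set y := L - w with hy
  have hy0 : 0 ≤ y := by linarith
  -- This is what makes N y² ≤ (N - 1)(y + w/2)² hold below.
  have hyN : y ≤ w * (N - 1) := by
    have e1 : √(M : ℝ) ≤ M := by
      rw [Real.sqrt_le_left (by linarith)]
      exact le_self_pow₀ hM' (by norm_num)
    have e2 : w * δ / 2 * √(M : ℝ) ≤ w * δ / 2 * M := by gcongr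
    have e3 : w * (δ * M) ≤ w * N := by gcongr
    have e4 : w * 2 ≤ w * N := by gcongr
    rw [pow_one, add_zero] at h4
    linarith
  have hQ : ∀ N', N - 1 ≤ N' → CRN.gaussQ (y + w / 2) ≤
      CRN.gaussQ (S / √((1 - p) * N' / (p * K))) := by
    intro N' hN'
    have hN'0 : 0 < N' := by linarith
    refine gaussQ_antitone ?_
    rw [div_le_iff₀ (Real.sqrt_pos.2 (by positivity))]
    refine hS.trans ?_
    rw [mul_comm]
    have h5 : √N * y ≤ √N' * (y + w / 2) := by
      refine le_of_sq_le_sq ?_ (by positivity)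
      rw [mul_pow, mul_pow, Real.sq_sqrt (by linarith), Real.sq_sqrt (by linarith)]
      have e1 : (N - 1) * (y + w / 2) ^ 2 ≤ N' * (y + w / 2) ^ 2 := by gcongr
      have e2 := mul_le_mul_of_nonneg_left hyN hy0
      have e3 : 0 ≤ (N - 1) * w ^ 2 := mul_nonneg (by linarith) (sq_nonneg _)
      linarith
    have e : ∀ n : ℝ, √((1 - p) * n / (p * K)) = √((1 - p) / (p * K)) * √n := fun n => by
      rw [← Real.sqrt_mul (by positivity)]
      congr 1
      ring
    rw [e, e]
    have := mul_le_mul_of_nonneg_left h5 (Real.sqrt_nonneg ((1 - p) / (p * K)))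
    linarith
  set q := CRN.gaussQ (y + w / 2) with hq
  have hq1 : q ≤ 1 := gaussQ_le_one _
  have hf1 := hQ N (by linarith)
  have hf2 := hQ ((M : ℝ) - 1 - c) (by linarith)
  unfold gaussFactor
  calc _ ≤ (1 - q) ^ c * (1 - q) ^ (M - c) := by
        have hg1 := gaussQ_le_one (S / √((1 - p) * N / (p * K)))
        have hg2 := gaussQ_le_one (S / √((1 - p) * ((M : ℝ) - 1 - c) / (p * K)))
        refine mul_le_mul (pow_le_pow_left₀ (by linarith) (by linarith) _)
          (pow_le_pow_left₀ (by linarith) (by linarith) _)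
          (pow_nonneg (by linarith) _) (pow_nonneg (by linarith) _)
    _ = (1 - q) ^ M := by rw [← pow_add, Nat.add_sub_cancel' hc]
    _ ≤ Real.exp (-q) ^ M := by
        refine pow_le_pow_left₀ (by linarith) ?_ _
        have := Real.add_one_le_exp (-q)
        linarith
    _ = Real.exp (-(M * q)) := by rw [← Real.exp_nat_mul, mul_neg]
    _ ≤ Real.exp (-A) := by
        refine Real.exp_le_exp.2 (neg_le_neg (h1.trans ?_))
        have h6 := le_gaussQ (z := y + w / 2) (u := w / 4) (by linarith) (by linarith)
        refine le_trans (le_of_eq ?_) (mul_le_mul_of_nonneg_left h6 (by linarith))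
        rw [← exp_critLevel_sq hM, mul_left_comm, ← Real.exp_add]
        change _ = _ * Real.exp (L ^ 2 / 2 + _)
        congr 2
        rw [hy]
        ring
    _ ≤ ε := hexp2

/-! ### The law of the counts of the local decisions -/

/-- The Stirling sequence n!/(√(2n) (n/e)ⁿ) decreases, so it is bounded by its value e/√2 at n = 1.
-/
lemma factorial_le_stirling {n : ℕ} (hn : 1 ≤ n) :
    (n ! : ℝ) ≤ Real.exp 1 * √n * (n / Real.exp 1) ^ n := by
  obtain ⟨m, rfl⟩ := Nat.exists_eq_add_of_le' hn
  have h := Stirling.stirlingSeq'_antitone (Nat.zero_le m)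
  simp only [Function.comp, Nat.succ_eq_add_one, zero_add, Stirling.stirlingSeq_one] at h
  unfold Stirling.stirlingSeq at h
  have hpos : 0 < √(2 * ((m + 1 : ℕ) : ℝ)) * (((m + 1 : ℕ) : ℝ) / Real.exp 1) ^ (m + 1) := by
    positivity
  rw [div_le_iff₀ hpos] at h
  refine h.trans (le_of_eq ?_)
  rw [Real.sqrt_mul (by norm_num)]
  field_simp

/-- The binomial weights are of order `1 / √N` away from the ends, uniformly in the parameter. -/
lemma choose_mul_pow_le {N n : ℕ} (hn : 1 ≤ n) (hnN : n + 1 ≤ N)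
    (hmid : (3 : ℝ) * N ^ 2 ≤ 16 * (n * (N - n))) {x y : ℝ} (hx : 0 ≤ x) (hy : 0 ≤ y) :
    (N.choose n : ℝ) * (x ^ n * y ^ (N - n)) ≤ 2 / √N * (x + y) ^ N := by
  obtain ⟨k, rfl⟩ := Nat.exists_eq_add_of_le (show n ≤ N by omega)
  have hk : 1 ≤ k := by omega
  rw [Nat.add_sub_cancel_left]
  have hn0 : (0 : ℝ) < n := by exact_mod_cast hn
  have hk0 : (0 : ℝ) < k := by exact_mod_cast hk
  push_cast at hmid ⊢
  rw [add_sub_cancel_left] at hmid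
  rcases eq_or_lt_of_le (add_nonneg hx hy) with hs | hs
  · have : x = 0 := by linarith
    rw [this, zero_pow (by omega)]
    simp only [zero_mul, mul_zero]
    positivity
  set e := Real.exp 1 with he
  have he0 : 0 < e := Real.exp_pos 1
  -- the entropy bound
  have hent : ((n + k : ℝ) ^ (n + k)) * (x ^ n * y ^ k) ≤ (n : ℝ) ^ n * k ^ k * (x + y) ^ (n + k) := by
    set a := (n + k) * x / (n * (x + y)) with ha
    set b := (n + k) * y / (k * (x + y)) with hb
    have ha0 : 0 ≤ a := by positivity
    have hb0 : 0 ≤ b := by positivity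
    -- From a ≤ exp(a - 1) and its analogue for b, since n(a - 1) + k(b - 1) = 0.
    have h1 : a ^ n * b ^ k ≤ 1 := by
      have e1 : a ≤ Real.exp (a - 1) := by linarith [Real.add_one_le_exp (a - 1)]
      have e2 : b ≤ Real.exp (b - 1) := by linarith [Real.add_one_le_exp (b - 1)]
      calc a ^ n * b ^ k ≤ Real.exp (a - 1) ^ n * Real.exp (b - 1) ^ k := by gcongr
        _ = Real.exp (n * (a - 1) + k * (b - 1)) := by
            rw [← Real.exp_nat_mul, ← Real.exp_nat_mul, ← Real.exp_add]
        _ = 1 := by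
            rw [Real.exp_eq_one_iff, ha, hb]
            field_simp
            ring
    have e3 : ((n + k : ℝ) ^ (n + k)) * (x ^ n * y ^ k) =
        (n : ℝ) ^ n * k ^ k * (x + y) ^ (n + k) * (a ^ n * b ^ k) := by
      rw [ha, hb, div_pow, div_pow, mul_pow, mul_pow, mul_pow, mul_pow, pow_add, pow_add]
      field_simp
    rw [e3]
    exact mul_le_of_le_one_right (by positivity) h1
  have h1 := factorial_le_stirling (n := n + k) (by omega)
  have h2 := Stirling.le_factorial_stirling n
  have h3 := Stirling.le_factorial_stirling k
  rw [← he] at h1 h2 h3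
  push_cast at h1
  have hchoose : (((n + k).choose n : ℕ) : ℝ) * (n ! * k !) = (n + k)! := by
    have := Nat.add_choose_mul_factorial_mul_factorial n k
    rw [← this]; push_cast
    rw [Nat.choose_symm_add]
    ring
  set D := √(2 * Real.pi * n) * (n / e) ^ n * (√(2 * Real.pi * k) * (k / e) ^ k) with hD
  have hD0 : 0 < D := by positivity
  have hD1 : D ≤ n ! * k ! := mul_le_mul h2 h3 (by positivity) (by positivity)
  have hmain : (((n + k).choose n : ℕ) : ℝ) * D ≤ e * √(n + k) * ((n + k) / e) ^ (n + k) := by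
    refine le_trans ?_ h1
    rw [← hchoose]
    gcongr
  have hDeq : D = 2 * Real.pi * √(n * k) * ((n : ℝ) ^ n * k ^ k / e ^ (n + k)) := by
    have e1 : ∀ z : ℝ, √(2 * Real.pi * z) = √(2 * Real.pi) * √z :=
      fun z => Real.sqrt_mul (by positivity) z
    rw [hD, e1, e1, Real.sqrt_mul hn0.le, div_pow, div_pow, pow_add]
    have : √(2 * Real.pi) * √(2 * Real.pi) = 2 * Real.pi := Real.mul_self_sqrt (by positivity)
    calc _ = √(2 * Real.pi) * √(2 * Real.pi) * (√n * √k) *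
          ((n : ℝ) ^ n / e ^ n * (k ^ k / e ^ k)) := by ring
      _ = _ := by rw [this]; field_simp
  have hroot : e * √(n + k : ℝ) ≤ 2 * Real.pi * √(n * k) * (2 / √(n + k : ℝ)) := by
    have hN0 : (0 : ℝ) < n + k := by positivity
    rw [← mul_div_assoc, le_div_iff₀ (Real.sqrt_pos.2 hN0), mul_assoc,
      Real.mul_self_sqrt hN0.le]
    have h4 : (n + k : ℝ) * (√3 / 4) ≤ √(n * k) := by
      refine Real.le_sqrt_of_sq_le ?_
      rw [mul_pow, div_pow, Real.sq_sqrt (by norm_num)]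
      linarith
    have h5 : 3 / 2 ≤ √3 := by
      refine Real.le_sqrt_of_sq_le (by norm_num)
    have h6 : (n + k : ℝ) * (3 / 8) ≤ √(n * k) := by
      refine le_trans ?_ h4
      exact mul_le_mul_of_nonneg_left (by linarith) hN0.le
    have h7 : e ≤ 3 := by rw [he]; linarith [Real.exp_one_lt_d9]
    have h8 := Real.pi_gt_three
    calc e * (n + k) ≤ 3 * (n + k) := by gcongr
      _ ≤ 2 * 3 * ((n + k) * (3 / 8)) * 2 := by linarith
      _ ≤ 2 * Real.pi * √(n * k) * 2 := by gcongr
  refine le_of_mul_le_mul_right ?_ hD0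
  calc (((n + k).choose n : ℕ) : ℝ) * (x ^ n * y ^ k) * D
      = (((n + k).choose n : ℕ) : ℝ) * D * (x ^ n * y ^ k) := by ring
    _ ≤ e * √(n + k) * ((n + k) / e) ^ (n + k) * (x ^ n * y ^ k) := by gcongr
    _ = e * √(n + k) / e ^ (n + k) * ((n + k : ℝ) ^ (n + k) * (x ^ n * y ^ k)) := by
        rw [div_pow]; ring
    _ ≤ 2 * Real.pi * √(n * k) * (2 / √(n + k : ℝ)) / e ^ (n + k) *
          ((n : ℝ) ^ n * k ^ k * (x + y) ^ (n + k)) := by gcongr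
    _ = 2 / √(n + k : ℝ) * (x + y) ^ (n + k) * D := by rw [hDeq]; ring

/-- Probability that the difference between the numbers of the two decisions lies in an interval. -/
lemma sum_choose_window_le {N : ℕ} (hN : 1 ≤ N) {x y : ℝ} (hx : 0 ≤ x) (hy : 0 ≤ y) {u v : ℝ}
    (hu : 0 ≤ u) (huv : u ≤ v) (hv : v ≤ N / 2) :
    ∑ n ∈ (Finset.range (N + 1)).filter fun n : ℕ => u < 2 * (n : ℝ) - N ∧ 2 * (n : ℝ) - N < v,
        (N.choose n : ℝ) * (x ^ n * y ^ (N - n)) ≤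
      ((v - u) / 2 + 1) * (2 / √N * (x + y) ^ N) := by
  have hN0 : (1 : ℝ) ≤ N := by exact_mod_cast hN
  set W := (Finset.range (N + 1)).filter fun n : ℕ => u < 2 * (n : ℝ) - N ∧ 2 * (n : ℝ) - N < v
  have hterm : ∀ n ∈ W, (N.choose n : ℝ) * (x ^ n * y ^ (N - n)) ≤ 2 / √N * (x + y) ^ N := by
    intro n hn
    obtain ⟨-, h1, h2⟩ := Finset.mem_filter.1 hn
    have h3 : (0 : ℝ) < n := by linarith
    have h4 : (n : ℝ) < N := by linarith
    -- The bounds on u and v force N/2 < n < 3N/4, hence n(N - n) ≥ 3N²/16.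
    refine choose_mul_pow_le (by exact_mod_cast h3) (by exact_mod_cast h4) ?_ hx hy
    nlinarith
  have hcard : (W.card : ℝ) ≤ (v - u) / 2 + 1 := by
    have hsub : W ⊆ Finset.Ioc ⌊(u + N) / 2⌋₊ ⌊(v + N) / 2⌋₊ := by
      intro n hn
      obtain ⟨-, h1, h2⟩ := Finset.mem_filter.1 hn
      rw [Finset.mem_Ioc, Nat.floor_lt (by linarith), Nat.le_floor_iff (by linarith)]
      constructor <;> linarith
    have h1 := Finset.card_le_card hsub
    rw [Nat.card_Ioc] at h1
    have h2 := Nat.floor_le (show 0 ≤ (v + N) / 2 by linarith)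
    have h3 := Nat.lt_floor_add_one ((u + N) / 2)
    have h4 : ⌊(u + N) / 2⌋₊ ≤ ⌊(v + N) / 2⌋₊ := Nat.floor_le_floor (by linarith)
    have h5 : (W.card : ℝ) ≤ (⌊(v + N) / 2⌋₊ : ℝ) - ⌊(u + N) / 2⌋₊ := by
      rw [← Nat.cast_sub h4]; exact_mod_cast h1
    linarith
  refine (Finset.sum_le_card_nsmul _ _ _ hterm).trans ?_
  rw [nsmul_eq_mul]
  gcongr

lemma sum_choose_pow (N : ℕ) (x y : ℝ) :
    ∑ n ∈ Finset.range (N + 1), (N.choose n : ℝ) * (x ^ n * y ^ (N - n)) = (x + y) ^ N := by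
  rw [add_pow]
  exact Finset.sum_congr rfl fun n _ => by ring

/-- Few users are active only with small probability. -/
lemma sum_choose_small_le {M : ℕ} {x y δ : ℝ} (hx : 0 ≤ x) (hxy : x + y = 1) (hδ : 0 ≤ δ)
    (hy : δ ≤ y) :
    ∑ c ∈ Finset.range (M + 1) with ((M - c : ℕ) : ℝ) < δ / 2 * M,
      (M.choose c : ℝ) * (x ^ c * y ^ (M - c)) ≤ Real.exp (-(δ * M / 10)) := by
  have hy0 : 0 ≤ y := hδ.trans hy
  set r := Real.exp (-1) with hr
  have hr0 : 0 < r := Real.exp_pos _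
  have hr1 : r < 2 / 5 := by have := Real.exp_neg_one_lt_d9; rw [hr]; linarith
  -- Chernoff's method with weight r = e⁻¹ per active user: x + r y ≤ exp(-3δ/5), and δ/2 - 3δ/5 =
  -- -δ/10.
  calc _ ≤ ∑ c ∈ Finset.range (M + 1) with ((M - c : ℕ) : ℝ) < δ / 2 * M,
        Real.exp (δ / 2 * M) * ((M.choose c : ℝ) * (x ^ c * (r * y) ^ (M - c))) := by
        refine Finset.sum_le_sum fun c hc => ?_
        have h := (Finset.mem_filter.1 hc).2
        have h1 : 1 ≤ Real.exp (δ / 2 * M) * r ^ (M - c) := by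
          rw [hr, ← Real.exp_nat_mul, ← Real.exp_add]
          exact Real.one_le_exp (by linarith)
        rw [mul_pow]
        calc _ ≤ (M.choose c : ℝ) * (x ^ c * y ^ (M - c)) *
              (Real.exp (δ / 2 * M) * r ^ (M - c)) := le_mul_of_one_le_right (by positivity) h1
          _ = _ := by ring
    _ ≤ ∑ c ∈ Finset.range (M + 1),
        Real.exp (δ / 2 * M) * ((M.choose c : ℝ) * (x ^ c * (r * y) ^ (M - c))) :=
        Finset.sum_le_sum_of_subset_of_nonneg (Finset.filter_subset _ _) fun _ _ _ => by positivity
    _ = Real.exp (δ / 2 * M) * (x + r * y) ^ M := by rw [← Finset.mul_sum, sum_choose_pow]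
    _ ≤ Real.exp (δ / 2 * M) * Real.exp (-(δ * (3 / 5))) ^ M := by
        have h1 : x + r * y ≤ Real.exp (-(δ * (3 / 5))) := by
          have h2 := Real.add_one_le_exp (-(δ * (3 / 5)))
          have h3 := mul_nonneg (sub_nonneg.2 hr1.le) hy0
          linarith
        gcongr
    _ = _ := by
        rw [← Real.exp_nat_mul, ← Real.exp_add]
        congr 1
        ring

/-- Standard deviation of the consensus statistic, up to the factor `M`, when `N` users are
active. -/
noncomputable def statScale (K : ℕ) (p : ℝ) (N : ℕ) : ℝ := √((1 - p) * (N : ℝ) / (p * K))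

/-- The counts `c` of censoring users and `n` of users with decision `1` for which few users are
active, or for which the sum of the decisions is close to the critical level. -/
def ExceptionalCount (M K : ℕ) (p δ w : ℝ) (c n : ℕ) : Prop :=
  ((M - c : ℕ) : ℝ) < δ / 2 * M ∨
    (statScale K p (M - c) * (critLevel M - w) < 2 * (n : ℝ) - (M - c : ℕ) ∧
      2 * (n : ℝ) - (M - c : ℕ) < statScale K p (M - c) * (critLevel M + w))

open Classical in
/-- The exceptional counts have small probability. -/
lemma exists_window_exceptional_le {p : ℝ} (hp0 : 0 < p) (hp1 : p < 1) {K : ℕ} (hK : 1 ≤ K)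
    {δ ε : ℝ} (hδ : 0 < δ) (hε : 0 < ε) :
    ∃ w > 0, ∀ᶠ M : ℕ in Filter.atTop, ∀ x z y : ℝ, 0 ≤ x → 0 ≤ z → 0 ≤ y → z + (x + y) = 1 →
      δ ≤ x + y →
      ∑ c ∈ Finset.range (M + 1), ∑ n ∈ Finset.range (M - c + 1),
        (M.choose c : ℝ) * z ^ c * (((M - c).choose n : ℝ) * (x ^ n * y ^ (M - c - n))) *
          (if ExceptionalCount M K p δ w c n then 1 else 0) ≤ ε := by
  have hK' : (0 : ℝ) < K := by exact_mod_cast hK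
  have hp1' : 0 < 1 - p := by linarith
  set β := √((1 - p) / (p * K)) with hβ
  have hβ0 : 0 < β := Real.sqrt_pos.2 (by positivity)
  have hscale : ∀ N : ℕ, statScale K p N = β * √(N : ℝ) := fun N => by
    unfold statScale
    rw [hβ, ← Real.sqrt_mul (by positivity)]
    congr 1
    ring
  -- The window bound is 2βw + 2/√N; this w makes the first term ε/4 for every N, and large M makes
  -- the second at most ε/4.
  set w := ε / (8 * β) with hw
  have hw0 : 0 < w := by positivity
  refine ⟨w, hw0, ?_⟩
  have hexp : ∀ᶠ M : ℕ in Filter.atTop, Real.exp (-(δ * M / 10)) ≤ ε / 2 := by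
    have h : Filter.Tendsto (fun M : ℕ => -(δ * (M : ℝ) / 10)) Filter.atTop Filter.atBot :=
      Filter.tendsto_neg_atTop_atBot.comp
        ((tendsto_natCast_atTop_atTop.const_mul_atTop hδ).atTop_div_const (by norm_num))
    filter_upwards [h.eventually (Filter.eventually_le_atBot (Real.log (ε / 2)))] with M hM
    exact (Real.exp_le_exp.2 hM).trans (Real.exp_log (half_pos hε)).le
  have hδ2 : 0 < √(δ / 2) := Real.sqrt_pos.2 (by positivity)
  filter_upwards [hexp, eventually_critLevel_pow_le 1 w (c := √(δ / 2) / (2 * β)) (by positivity),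
    eventually_critLevel (Filter.eventually_ge_atTop w),
    tendsto_natCast_atTop_atTop.eventually (Filter.eventually_ge_atTop (128 / (δ * ε ^ 2))),
    Filter.eventually_ge_atTop 1] with M h1 h2 h3 h4 hM x z y hx hz hy hsum hδxy
  have hM' : (1 : ℝ) ≤ M := by exact_mod_cast hM
  set a := x + y with ha
  have ha0 : 0 ≤ a := add_nonneg hx hy
  have hinner : ∀ c ∈ Finset.range (M + 1), ∑ n ∈ Finset.range (M - c + 1),
      (M.choose c : ℝ) * z ^ c * (((M - c).choose n : ℝ) * (x ^ n * y ^ (M - c - n))) *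
          (if ExceptionalCount M K p δ w c n then 1 else 0) ≤
      (if ((M - c : ℕ) : ℝ) < δ / 2 * M then (M.choose c : ℝ) * (z ^ c * a ^ (M - c)) else 0) +
        ε / 2 * ((M.choose c : ℝ) * (z ^ c * a ^ (M - c))) := by
    intro c _
    set N := M - c
    simp only [mul_assoc, ← Finset.mul_sum]
    split_ifs with hsmall
    · have h5 : ∑ n ∈ Finset.range (N + 1), (N.choose n : ℝ) * (x ^ n * (y ^ (N - n) *
          (if ExceptionalCount M K p δ w c n then 1 else 0))) ≤ a ^ N := by
        rw [ha, ← sum_choose_pow]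
        refine Finset.sum_le_sum fun n _ => ?_
        gcongr
        exact mul_le_of_le_one_right (by positivity) (by split_ifs <;> norm_num)
      have h6 : 0 ≤ ε / 2 * ((M.choose c : ℝ) * (z ^ c * a ^ N)) := by positivity
      have h7 : (M.choose c : ℝ) * (z ^ c * ∑ n ∈ Finset.range (N + 1), (N.choose n : ℝ) *
          (x ^ n * (y ^ (N - n) * (if ExceptionalCount M K p δ w c n then 1 else 0)))) ≤
          (M.choose c : ℝ) * (z ^ c * a ^ N) := by gcongr
      linarith
    · push Not at hsmall
      have hN0 : (0 : ℝ) < N := lt_of_lt_of_le (by positivity) hsmall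
      have hN1 : 1 ≤ N := by exact_mod_cast hN0
      have hsqN : 0 < √(N : ℝ) := Real.sqrt_pos.2 hN0
      have hlow : √(δ / 2) * √(M : ℝ) ≤ √(N : ℝ) := by
        rw [← Real.sqrt_mul (by positivity)]
        exact Real.sqrt_le_sqrt hsmall
      have hsq8 : 8 / ε ≤ √(N : ℝ) := by
        refine Real.le_sqrt_of_sq_le (le_trans ?_ hsmall)
        rw [div_le_iff₀ (by positivity)] at h4
        rw [div_pow, div_le_iff₀ (by positivity)]
        linarith
      have hwin := sum_choose_window_le hN1 hx hy (u := β * √(N : ℝ) * (critLevel M - w))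
        (v := β * √(N : ℝ) * (critLevel M + w))
        (mul_nonneg (by positivity) (by linarith))
        (by gcongr; linarith) (by
          have h5 : β * (critLevel M + w) ≤ √(N : ℝ) / 2 := by
            rw [pow_one] at h2
            have := mul_le_mul_of_nonneg_left h2 hβ0.le
            have e : β * (√(δ / 2) / (2 * β) * √(M : ℝ)) = √(δ / 2) * √(M : ℝ) / 2 := by
              field_simp
            linarith
          have := mul_le_mul_of_nonneg_left h5 hsqN.le
          have e := Real.mul_self_sqrt hN0.le
          linarith)
      have h5 : ∑ n ∈ Finset.range (N + 1), (N.choose n : ℝ) * (x ^ n * (y ^ (N - n) *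
          (if ExceptionalCount M K p δ w c n then 1 else 0))) ≤ ε / 2 * a ^ N := by
        refine le_trans (le_of_eq ?_) (hwin.trans ?_)
        · rw [Finset.sum_filter]
          refine Finset.sum_congr rfl fun n _ => ?_
          have : ExceptionalCount M K p δ w c n ↔
              β * √(N : ℝ) * (critLevel M - w) < 2 * (n : ℝ) - N ∧
                2 * (n : ℝ) - N < β * √(N : ℝ) * (critLevel M + w) := by
            unfold ExceptionalCount
            rw [hscale]
            exact or_iff_right (not_lt.2 hsmall)
          simp only [this]
          split_ifs <;> simp
        · rw [← mul_assoc]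
          refine mul_le_mul_of_nonneg_right ?_ (by positivity)
          have e : ((β * √(N : ℝ) * (critLevel M + w) - β * √(N : ℝ) * (critLevel M - w)) / 2 + 1) *
              (2 / √(N : ℝ)) = 2 * (β * w) + 2 / √(N : ℝ) := by
            field_simp
            ring
          have e2 : β * w = ε / 8 := by rw [hw]; field_simp
          have e3 : 2 / √(N : ℝ) ≤ ε / 4 := by
            rw [div_le_iff₀ hsqN]
            rw [div_le_iff₀ hε] at hsq8
            linarith
          rw [e, e2]
          linarith
      have h7 : (M.choose c : ℝ) * (z ^ c * ∑ n ∈ Finset.range (N + 1), (N.choose n : ℝ) *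
          (x ^ n * (y ^ (N - n) * (if ExceptionalCount M K p δ w c n then 1 else 0)))) ≤
          (M.choose c : ℝ) * (z ^ c * (ε / 2 * a ^ N)) := by gcongr
      linarith
  refine (Finset.sum_le_sum hinner).trans ?_
  rw [Finset.sum_add_distrib, ← Finset.sum_filter, ← Finset.mul_sum, sum_choose_pow, hsum, one_pow]
  have := sum_choose_small_le (M := M) hz hsum hδ.le hδxy
  linarith

/-! ### Decomposition by the local decisions -/

/-- The number of users with the decision `σ`. -/
def decisionCount {M : ℕ} (s : Fin M → SignType) (σ : SignType) : ℕ :=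
  (Finset.univ.filter fun j => s j = σ).card

/-- The decision vector with integer entries. -/
def intDecision {M : ℕ} (s : Fin M → SignType) (j : Fin M) : ℤ := (s j : ℤ)

lemma intDecision_mem {M : ℕ} (s : Fin M → SignType) (j : Fin M) :
    intDecision s j = 1 ∨ intDecision s j = 0 ∨ intDecision s j = -1 := by
  unfold intDecision
  cases s j <;> simp

lemma intDecision_eq_iff {M : ℕ} (s : Fin M → SignType) (j : Fin M) :
    intDecision s j ≠ 0 ↔ s j ≠ 0 := by
  unfold intDecision
  cases s j <;> simp

lemma decisionCount_add_activeCount {M : ℕ} (s : Fin M → SignType) :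
    decisionCount s 0 + activeCount (intDecision s) = M := by
  unfold decisionCount activeCount
  simp only [intDecision_eq_iff]
  rw [Finset.card_filter_add_card_filter_not]
  simp

lemma decisionCount_add {M : ℕ} (s : Fin M → SignType) :
    decisionCount s 0 + decisionCount s 1 + decisionCount s (-1) = M := by
  have h : ∑ j : Fin M, ((if s j = 0 then 1 else 0) + (if s j = 1 then 1 else 0) +
      (if s j = -1 then 1 else 0)) = M := by
    rw [Finset.sum_congr rfl (g := fun _ => 1)]
    · simp
    · intro j _
      cases s j <;> rfl
  rw [Finset.sum_add_distrib, Finset.sum_add_distrib] at h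
  unfold decisionCount
  rw [Finset.card_filter, Finset.card_filter, Finset.card_filter]
  exact h

lemma sum_intDecision {M : ℕ} (s : Fin M → SignType) :
    ∑ j, (intDecision s j : ℝ) = 2 * (decisionCount s 1 : ℝ) - ((M : ℝ) - decisionCount s 0) := by
  have h1 : ∑ j, (intDecision s j : ℝ) = (decisionCount s 1 : ℝ) - decisionCount s (-1) := by
    unfold decisionCount intDecision
    rw [Finset.card_filter, Finset.card_filter, Nat.cast_sum, Nat.cast_sum, ← Finset.sum_sub_distrib]
    refine Finset.sum_congr rfl fun j _ => ?_
    cases s j <;> simp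
  have h2 : (M : ℝ) = decisionCount s 0 + decisionCount s 1 + decisionCount s (-1) := by
    exact_mod_cast (decisionCount_add s).symm
  rw [h1, h2]
  ring

lemma prod_comp_decision {M : ℕ} (s : Fin M → SignType) (q : SignType → ℝ) :
    ∏ i, q (s i) = q 0 ^ decisionCount s 0 *
      (q 1 ^ decisionCount s 1 * q (-1) ^ (M - decisionCount s 0 - decisionCount s 1)) := by
  have e : M - decisionCount s 0 - decisionCount s 1 = decisionCount s (-1) := by
    have := decisionCount_add s
    omega
  have h : ∀ i, q (s i) = (if s i = 0 then q 0 else 1) *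
      ((if s i = 1 then q 1 else 1) * (if s i = -1 then q (-1) else 1)) := fun i => by
    cases s i <;> simp
  rw [e, Finset.prod_congr rfl fun i _ => h i, Finset.prod_mul_distrib, Finset.prod_mul_distrib]
  simp only [Finset.prod_ite, Finset.prod_const, one_pow, mul_one]
  rfl

/-- Sums over the decision vectors of functions of the counts. -/
lemma sum_decision_eq {M : ℕ} (q : SignType → ℝ) (F : ℕ → ℕ → ℝ) :
    ∑ s : Fin M → SignType, (∏ i, q (s i)) * F (decisionCount s 0) (decisionCount s 1) =
      ∑ c ∈ Finset.range (M + 1), ∑ n ∈ Finset.range (M - c + 1),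
        (M.choose c : ℝ) * q 0 ^ c *
          (((M - c).choose n : ℝ) * (q 1 ^ n * q (-1) ^ (M - c - n))) * F c n := by
  simp only [prod_comp_decision]
  set f : ℕ → ℕ → ℝ := fun c n => q 0 ^ c * (q 1 ^ n * q (-1) ^ (M - c - n)) * F c n with hf
  have h1 : ∑ s : Fin M → SignType, f (decisionCount s 0) (decisionCount s 1) =
      ∑ C ∈ (Finset.univ : Finset (Fin M)).powerset, ∑ P ∈ (Finset.univ \ C).powerset,
        f C.card P.card := by
    rw [Finset.sum_sigma']
    -- A decision vector amounts to its censoring set together with, inside the complement, the set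
    -- of users with decision 1.
    refine Finset.sum_bij'
      (i := fun s _ => (⟨Finset.univ.filter fun j => s j = 0, Finset.univ.filter fun j => s j = 1⟩ :
        (_ : Finset (Fin M)) × Finset (Fin M)))
      (j := fun x _ => fun k => if k ∈ x.1 then (0 : SignType) else if k ∈ x.2 then 1 else -1)
      ?_ ?_ ?_ ?_ ?_
    · intro s _
      simp only [Finset.mem_sigma, Finset.mem_powerset, Finset.subset_univ, true_and]
      intro j hj
      simp only [Finset.mem_filter, Finset.mem_univ, true_and, Finset.mem_sdiff] at hj ⊢
      rw [hj]; decide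
    · exact fun _ _ => Finset.mem_univ _
    · intro s _
      ext k
      simp only [Finset.mem_filter, Finset.mem_univ, true_and]
      cases s k <;> rfl
    · rintro ⟨C, P⟩ hx
      simp only [Finset.mem_sigma, Finset.mem_powerset, Finset.subset_univ, true_and] at hx
      have hCP : ∀ k, k ∈ P → k ∉ C := fun k hk => (Finset.mem_sdiff.1 (hx hk)).2
      have e1 : (Finset.univ.filter fun k =>
          (if k ∈ C then (0 : SignType) else if k ∈ P then 1 else -1) = 0) = C := by
        ext k
        simp only [Finset.mem_filter, Finset.mem_univ, true_and]
        split_ifs <;> simp_all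
      have e2 : (Finset.univ.filter fun k =>
          (if k ∈ C then (0 : SignType) else if k ∈ P then 1 else -1) = 1) = P := by
        ext k
        have := hCP k
        simp only [Finset.mem_filter, Finset.mem_univ, true_and]
        split_ifs with h1 h2
        · refine iff_of_false (by decide) ?_
          exact fun h => this h h1
        · simpa using h2
        · exact iff_of_false (by decide) h2
      simp only [e1, e2]
    · exact fun s _ => rfl
  rw [h1]
  have h2 : ∀ C ∈ (Finset.univ : Finset (Fin M)).powerset,
      ∑ P ∈ (Finset.univ \ C).powerset, f C.card P.card =
        ∑ n ∈ Finset.range (M - C.card + 1), ((M - C.card).choose n : ℝ) * f C.card n := by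
    intro C _
    rw [Finset.sum_powerset_apply_card, Finset.card_sdiff_of_subset (Finset.subset_univ _),
      Finset.card_univ, Fintype.card_fin]
    simp only [nsmul_eq_mul]
  rw [Finset.sum_congr rfl h2, Finset.sum_powerset_apply_card
    (f := fun c => ∑ n ∈ Finset.range (M - c + 1), ((M - c).choose n : ℝ) * f c n),
    Finset.card_univ, Fintype.card_fin]
  refine Finset.sum_congr rfl fun c _ => ?_
  rw [nsmul_eq_mul, Finset.mul_sum]
  refine Finset.sum_congr rfl fun n _ => ?_
  rw [hf]
  ring

/-! ### Reduction of both probabilities to sums over decision vectors -/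

lemma measurable_localDecision (η₀ η₁ : ℝ) : Measurable (CRN.localDecision η₀ η₁) := by
  unfold CRN.localDecision
  exact Measurable.ite measurableSet_Ici measurable_const
    (Measurable.ite measurableSet_Ici measurable_const measurable_const)

lemma measurableSet_localDecision (η₀ η₁ r : ℝ) :
    MeasurableSet {x | CRN.localDecision η₀ η₁ x = r} :=
  measurable_localDecision η₀ η₁ (measurableSet_singleton r)

lemma exists_localDecision_eq (η₀ η₁ x : ℝ) :
    ∃ σ : SignType, CRN.localDecision η₀ η₁ x = ((σ : ℤ) : ℝ) := by
  unfold CRN.localDecision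
  split_ifs
  · exact ⟨1, by simp⟩
  · exact ⟨0, by simp⟩
  · exact ⟨-1, by simp⟩

lemma signType_cast_injective : Function.Injective fun σ : SignType => ((σ : ℤ) : ℝ) := by
  intro a b h
  have h2 : ((a : ℤ) : ℝ) = ((b : ℤ) : ℝ) := h
  have h' : (a : ℤ) = (b : ℤ) := by exact_mod_cast h2
  revert h'
  cases a <;> cases b <;> simp

/-- A graph is determined by its edge set, which depends measurably on it. Consequently every set of
link graphs over finitely many users and time steps is measurable. -/
instance {V : Type*} [Countable V] : MeasurableSingletonClass (SimpleGraph V) where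
  measurableSet_singleton g := by
    have : ({g} : Set (SimpleGraph V)) = SimpleGraph.edgeSet ⁻¹' {g.edgeSet} := by
      ext h
      simp
    rw [this]
    exact SimpleGraph.measurable_edgeSet (measurableSet_singleton _)

/-- Conditioning on the decision vector: the event is a disjoint union of rectangles, a product
event for the measurements times an event for the graphs. -/
lemma globalProb_eq_sum (M K : ℕ) (p : unitInterval) (ν : Measure ℝ) [IsProbabilityMeasure ν]
    (η₀ η₁ : ℝ) :
    CRN.globalProb M K p ν η₀ η₁ = ∑ s : Fin M → SignType,
      (∏ i, CRN.decisionProb ν η₀ η₁ ((s i : ℤ) : ℝ)) * passProb K p (intDecision s) := by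
  classical
  set A : (Fin M → SignType) → Set (Fin M → ℝ) := fun s =>
    Set.univ.pi fun i => {x | CRN.localDecision η₀ η₁ x = ((s i : ℤ) : ℝ)}
  set B : (Fin M → SignType) → Set (Fin K → SimpleGraph (Fin M)) := fun s =>
    {g | ∀ i, CRN.finalDecision (p : ℝ) (fun j => (intDecision s j : ℝ)) g i = 1}
  have hset : {ω : (Fin M → ℝ) × (Fin K → SimpleGraph (Fin M)) |
      ∀ i, CRN.finalDecision (p : ℝ) (fun j => CRN.localDecision η₀ η₁ (ω.1 j)) ω.2 i = 1} =
      ⋃ s ∈ (Finset.univ : Finset (Fin M → SignType)), A s ×ˢ B s := by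
    ext ω
    simp only [Set.mem_ofPred_eq, Finset.mem_univ, Set.iUnion_true, Set.mem_iUnion, Set.mem_prod,
      A, B, Set.mem_univ_pi]
    constructor
    · intro h
      choose s hs using fun j => exists_localDecision_eq η₀ η₁ (ω.1 j)
      refine ⟨s, hs, ?_⟩
      simpa only [hs, intDecision] using h
    · rintro ⟨s, hs, h⟩
      simpa only [hs, intDecision] using h
  have hmeas : ∀ s, MeasurableSet (A s ×ˢ B s) := fun s =>
    (MeasurableSet.univ_pi fun i => measurableSet_localDecision _ _ _).prod
      (Set.toFinite _).measurableSet
  have hdisj : ((Finset.univ : Finset (Fin M → SignType)) : Set (Fin M → SignType)).PairwiseDisjoint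
      fun s => A s ×ˢ B s := by
    intro s _ s' _ hne
    rw [Function.onFun, Set.disjoint_left]
    rintro ω ⟨h1, -⟩ ⟨h2, -⟩
    refine hne (funext fun i => signType_cast_injective ?_)
    have e1 : CRN.localDecision η₀ η₁ (ω.1 i) = ((s i : ℤ) : ℝ) := h1 i (Set.mem_univ i)
    have e2 : CRN.localDecision η₀ η₁ (ω.1 i) = ((s' i : ℤ) : ℝ) := h2 i (Set.mem_univ i)
    exact e1.symm.trans e2
  unfold CRN.globalProb CRN.networkLaw
  rw [hset, measureReal_biUnion_finset hdisj fun s _ => hmeas s]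
  refine Finset.sum_congr rfl fun s _ => ?_
  rw [measureReal_prod_prod]
  congr 1
  simp only [measureReal_def, A, Measure.pi_pi, ENNReal.toReal_prod]
  rfl

lemma sum_decisionProb (ν : Measure ℝ) [IsProbabilityMeasure ν] (η₀ η₁ : ℝ) :
    CRN.decisionProb ν η₀ η₁ 0 + (CRN.decisionProb ν η₀ η₁ 1 + CRN.decisionProb ν η₀ η₁ (-1)) = 1 := by
  have hU : (⋃ σ ∈ (Finset.univ : Finset SignType),
      {x | CRN.localDecision η₀ η₁ x = ((σ : ℤ) : ℝ)}) = Set.univ := by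
    refine Set.eq_univ_of_forall fun x => ?_
    obtain ⟨σ, hσ⟩ := exists_localDecision_eq η₀ η₁ x
    simp only [Set.mem_iUnion]
    exact ⟨σ, Finset.mem_univ _, hσ⟩
  have h := measureReal_biUnion_finset (μ := ν) (s := (Finset.univ : Finset SignType))
    (f := fun σ => {x | CRN.localDecision η₀ η₁ x = ((σ : ℤ) : ℝ)})
    (fun σ _ σ' _ hne => by
      rw [Function.onFun, Set.disjoint_left]
      intro x h1 h2
      exact hne (signType_cast_injective (h1.symm.trans h2)))
    fun σ _ => measurableSet_localDecision _ _ _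
  rw [hU, probReal_univ] at h
  have hs : (Finset.univ : Finset SignType) = {0, -1, 1} := rfl
  rw [hs, Finset.sum_insert (by decide), Finset.sum_insert (by decide), Finset.sum_singleton] at h
  simp only [SignType.coe_zero, SignType.coe_neg_one, SignType.coe_one, Int.cast_zero,
    Int.cast_neg, Int.cast_one] at h
  unfold CRN.decisionProb
  linarith

/-- The multinomial coefficient is a product of two binomial ones, so the formula is an expectation
over the same decision vectors as the true probability and the two can be compared term by term. -/
lemma approxSum_eq (M K : ℕ) (p : ℝ) (q : SignType → ℝ) :
    CRN.approxSum M K p (q 1) (q 0) (q (-1)) = ∑ s : Fin M → SignType, (∏ i, q (s i)) *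
      gaussFactor M K p (decisionCount s 0)
        (2 * (decisionCount s 1 : ℝ) - ((M : ℝ) - decisionCount s 0)) := by
  rw [sum_decision_eq q fun c n => gaussFactor M K p c (2 * (n : ℝ) - ((M : ℝ) - c))]
  unfold CRN.approxSum gaussFactor
  refine Finset.sum_congr rfl fun c hc => Finset.sum_congr rfl fun n hn => ?_
  have hc' : c ≤ M := Nat.lt_succ_iff.1 (Finset.mem_range.1 hc)
  have hn' : n ≤ M - c := Nat.lt_succ_iff.1 (Finset.mem_range.1 hn)
  have e : M - n - c = M - c - n := by omega
  have hcoef : (M ! : ℝ) / ((n ! : ℝ) * (c ! : ℝ) * ((M - n - c)! : ℝ)) =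
      (M.choose c : ℝ) * ((M - c).choose n : ℝ) := by
    rw [div_eq_iff (by positivity), ← Nat.choose_mul_factorial_mul_factorial hc',
      ← Nat.choose_mul_factorial_mul_factorial hn', e]
    push_cast
    ring
  rw [hcoef, e]
  ring

/-! ### Comparison of the two expectations -/

/-- The Gaussian approximation of the probability of a unanimous decision. -/
lemma eventually_abs_globalProb_sub_le {p : unitInterval} (hp₀ : 0 < p) (hp₁ : p < 1) {K : ℕ}
    (hK : 1 ≤ K) {δ ε : ℝ} (hδ : 0 < δ) (hε : 0 < ε) :
    ∀ᶠ M : ℕ in Filter.atTop, ∀ ν : Measure ℝ, IsProbabilityMeasure ν → ∀ η₀ η₁ : ℝ,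
      CRN.decisionProb ν η₀ η₁ 0 ≤ 1 - δ →
      |CRN.globalProb M K p ν η₀ η₁ - CRN.approxSum M K p (CRN.decisionProb ν η₀ η₁ 1)
        (CRN.decisionProb ν η₀ η₁ 0) (CRN.decisionProb ν η₀ η₁ (-1))| ≤ ε := by
  classical
  have hp0' : (0 : ℝ) < p := hp₀
  have hp1' : (p : ℝ) < 1 := hp₁
  obtain ⟨w, hw, hwin⟩ := exists_window_exceptional_le hp0' hp1' hK hδ (half_pos hε)
  filter_upwards [hwin,
    eventually_one_sub_le_passProb hp₀ hp₁ hK (half_pos hδ) hw (half_pos hε),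
    eventually_passProb_le hp₀ hp₁ hK (half_pos hδ) hw (half_pos hε),
    eventually_one_sub_le_gaussFactor hp0' hp1' hK (half_pos hδ) hw (half_pos hε),
    eventually_gaussFactor_le hp0' hp1' hK (half_pos hδ) hw (half_pos hε)]
    with M h1 h2 h3 h4 h5 ν hν η₀ η₁ hcens
  set q : SignType → ℝ := fun σ => CRN.decisionProb ν η₀ η₁ ((σ : ℤ) : ℝ) with hq
  have hq0 : ∀ σ, 0 ≤ q σ := fun σ => measureReal_nonneg
  have e1 : CRN.decisionProb ν η₀ η₁ 1 = q 1 := by simp [hq]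
  have e0 : CRN.decisionProb ν η₀ η₁ 0 = q 0 := by simp [hq]
  have e2 : CRN.decisionProb ν η₀ η₁ (-1) = q (-1) := by simp [hq]
  have hsum := sum_decisionProb ν η₀ η₁
  rw [e0] at hcens
  rw [e0, e1, e2] at hsum
  rw [e0, e1, e2, approxSum_eq, globalProb_eq_sum, ← Finset.sum_sub_distrib]
  -- Outside the exceptional counts at least δ/2 of the users are active, and the two conditional
  -- quantities are both within ε/2 of 0 or both within ε/2 of 1. On the exceptional counts their
  -- difference is at most 1, which the window estimate makes affordable.
  have hterm : ∀ s : Fin M → SignType,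
      |(∏ i, CRN.decisionProb ν η₀ η₁ ((s i : ℤ) : ℝ)) * passProb K p (intDecision s) -
        (∏ i, q (s i)) * gaussFactor M K p (decisionCount s 0)
          (2 * (decisionCount s 1 : ℝ) - ((M : ℝ) - decisionCount s 0))| ≤
      (∏ i, q (s i)) * (ε / 2) + (∏ i, q (s i)) *
        (if ExceptionalCount M K p δ w (decisionCount s 0) (decisionCount s 1) then 1 else 0) := by
    intro s
    have hprod : 0 ≤ ∏ i, q (s i) := Finset.prod_nonneg fun i _ => hq0 _
    change |(∏ i, q (s i)) * _ - _| ≤ _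
    rw [← mul_sub, abs_mul, abs_of_nonneg hprod, ← mul_add]
    refine mul_le_mul_of_nonneg_left ?_ hprod
    rw [← sum_intDecision]
    set S := ∑ j, (intDecision s j : ℝ) with hS
    set c := decisionCount s 0
    have hact : M - c = activeCount (intDecision s) := by
      have := decisionCount_add_activeCount s
      omega
    have hc : c ≤ M := by
      have := decisionCount_add_activeCount s
      omega
    have g1 := passProb_nonneg (K := K) p (intDecision s)
    have g2 := passProb_le_one (K := K) p (intDecision s)
    have g3 := gaussFactor_nonneg M K p c S
    have g4 := gaussFactor_le_one M K p c S
    split_ifs with hex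
    · rw [abs_le]
      constructor <;> linarith
    · unfold ExceptionalCount at hex
      rw [not_or, not_and_or, not_lt, not_lt, not_lt] at hex
      have hSeq : 2 * (decisionCount s 1 : ℝ) - ((M - c : ℕ) : ℝ) = S := by
        rw [hS, sum_intDecision, Nat.cast_sub hc]
      rw [hSeq] at hex
      unfold statScale at hex
      obtain ⟨hN, hex | hex⟩ := hex
      · have k1 := h3 (intDecision s) (intDecision_mem s) (hact ▸ hN) (hact ▸ hex)
        have k2 := h5 c hc S hN hex
        rw [abs_le]
        constructor <;> linarith
      · have k1 := h2 (intDecision s) (intDecision_mem s) (hact ▸ hN) (hact ▸ hex)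
        have k2 := h4 c hc S hN hex
        rw [abs_le]
        constructor <;> linarith
  refine (Finset.abs_sum_le_sum_abs _ _).trans
    ((Finset.sum_le_sum fun s _ => hterm s).trans ?_)
  rw [Finset.sum_add_distrib, ← Finset.sum_mul,
    sum_decision_eq q fun c n => if ExceptionalCount M K p δ w c n then 1 else 0]
  have htotal : ∑ s : Fin M → SignType, ∏ i, q (s i) = 1 := by
    have h := Finset.prod_univ_sum (fun _ : Fin M => (Finset.univ : Finset SignType))
      fun _ σ => q σ
    rw [Fintype.piFinset_univ] at h
    have hs : (Finset.univ : Finset SignType) = {0, -1, 1} := rfl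
    rw [← h, hs, Finset.prod_const, Finset.sum_insert (by decide), Finset.sum_insert (by decide),
      Finset.sum_singleton, add_comm (q (-1)), hsum, one_pow]
  have hbad := h1 (q 1) (q 0) (q (-1)) (hq0 _) (hq0 _) (hq0 _) hsum (by linarith)
  rw [htotal, one_mul]
  linarith

theorem mainTheorem1 (p : unitInterval) (hp₀ : 0 < p) (hp₁ : p < 1) (K : ℕ) (hK : 1 ≤ K)
    (δ : ℝ) (hδ : 0 < δ) (ε : ℝ) (hε : 0 < ε) :
    ∃ M₀ : ℕ, ∀ M : ℕ, M₀ ≤ M →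
      ∀ ν : CRN.Hypothesis → Measure ℝ, (∀ h, IsProbabilityMeasure (ν h)) →
      ∀ η₀ η₁ : ℝ, η₀ ≤ η₁ →
      (∀ h, CRN.decisionProb (ν h) η₀ η₁ 0 ≤ 1 - δ) →
        |CRN.detectionProb M K p ν η₀ η₁ -
          CRN.approxSum M K p
            (CRN.decisionProb (ν CRN.Hypothesis.H1) η₀ η₁ 1)
            (CRN.decisionProb (ν CRN.Hypothesis.H1) η₀ η₁ 0)
            (CRN.decisionProb (ν CRN.Hypothesis.H1) η₀ η₁ (-1))| ≤ ε ∧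
        |CRN.falseAlarmProb M K p ν η₀ η₁ -
          CRN.approxSum M K p
            (CRN.decisionProb (ν CRN.Hypothesis.H0) η₀ η₁ 1)
            (CRN.decisionProb (ν CRN.Hypothesis.H0) η₀ η₁ 0)
            (CRN.decisionProb (ν CRN.Hypothesis.H0) η₀ η₁ (-1))| ≤ ε := by
  obtain ⟨M₀, hM₀⟩ := Filter.eventually_atTop.1
    (eventually_abs_globalProb_sub_le hp₀ hp₁ hK hδ hε)
  exact ⟨M₀, fun M hM ν hν η₀ η₁ _ hcens =>
    ⟨hM₀ M hM (ν CRN.Hypothesis.H1) (hν _) η₀ η₁ (hcens _),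
      hM₀ M hM (ν CRN.Hypothesis.H0) (hν _) η₀ η₁ (hcens _)⟩⟩
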